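/- Let $T>1$, $c(T)=\cos\frac{\pi}{T}$ and $E(T)=\cot^2\left(\frac{\pi}{4T}\right)$. For integers $n\ge 0$ put $\phi_n(x)=\cos\frac{n\pi}{T}x$ and $\phi_{-(n+1)}(x)=\sin\frac{(n+1)\pi}{T}x$. For an integer $N\ge 1$ let $$x_n=-x_{-n-1}=\frac{T}{\pi}\arccos\left[\tfrac12(1-c(T))\cos\left(\frac{(2n+1)\pi}{2N+2}\right)+\tfrac12(1+c(T))\right],\qquad n=0,\ldots,N,$$ be the mapped symmetric Chebyshev nodes, and let $\tilde A\in\mathbb{R}^{(2N+2)\times(2N+2)}$ be the matrix of the discrete Fourier extension, with entries $$\tilde A_{n,m}=\sqrt{\frac{\pi}{N+1}}\,\phi_m(x_n),\qquad n,m=-N-1,\ldots,N.$$ Then there are positive constants $c_1(T),c_2(T),d_1(T),d_2(T)$, depending only on $T$ and bounded from above and away from zero as $T\to1^+$, such that for all $T>1$ and all integers $N\ge1$ the largest and smallest singular values of $\tilde A$ satisfy $$c_1(T)\le\sigma_{\max}(\tilde A)\le c_2(T)N^{3/2},\qquad d_1(T)N^{-3/2}E(T)^{-N}\le\sigma_{\min}(\tilde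 A)\le d_2(T)N^{5/2}E(T)^{-N}.$$ Moreover, for each fixed $T>1$, the condition number $\kappa(\tilde A)=\sigma_{\max}(\tilde A)/\sigma_{\min}(\tilde A)$ is $O(E(T)^N)$ as $N\to\infty$, and it grows exponentially at exactly this rate: $\kappa(\tilde A)^{1/N}\to E(T)$ as $N\to\infty$. -/

import Mathlib

open Filter Topology Asymptotics

noncomputable section

/-- The constant `E(T) = cot² (π / (4T))`. -/
def extConst (T : ℝ) : ℝ := Real.cot (Real.pi / (4 * T)) ^ 2

/-- The constant `c(T) = cos (π / T)`. -/
def cosConst (T : ℝ) : ℝ := Real.cos (Real.pi / T)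

/-- The basis functions, indexed by all integers:
`φ_n(x) = cos (n π x / T)` and `φ_{-(n+1)}(x) = sin ((n+1) π x / T)` for `n = 0, 1, 2, …`. -/
def basisFun (T : ℝ) : ℤ → ℝ → ℝ
  | Int.ofNat n, x => Real.cos (n * Real.pi / T * x)
  | Int.negSucc n, x => Real.sin ((n + 1) * Real.pi / T * x)

/-- The mapped Chebyshev node in `[0, 1]` with index `n = 0, …, N`. -/
def posNode (T : ℝ) (N n : ℕ) : ℝ :=
  T / Real.pi *
    Real.arccos (1 / 2 * (1 - cosConst T) * Real.cos ((2 * n + 1) * Real.pi / (2 * N + 2))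
      + 1 / 2 * (1 + cosConst T))

/-- The mapped symmetric Chebyshev nodes: `x_n` for `n = 0, …, N` is the mapped Chebyshev node,
and `x_{-n-1} = -x_n`. -/
def mappedNode (T : ℝ) (N : ℕ) : ℤ → ℝ
  | Int.ofNat n => posNode T N n
  | Int.negSucc n => -posNode T N n

/-- The index set `{-N-1, …, N}`. -/
abbrev FEIndex (N : ℕ) : Type := Finset.Icc (-(N : ℤ) - 1) (N : ℤ)

/-- The `(2N+2) × (2N+2)` matrix of the discrete Fourier extension, with entries
`√(π / (N+1)) φ_m(x_n)` for `n, m = -N-1, …, N`. -/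
def discMatrix (T : ℝ) (N : ℕ) : Matrix (FEIndex N) (FEIndex N) ℝ :=
  Matrix.of fun n m => √(Real.pi / (N + 1)) * basisFun T m (mappedNode T N n)

/-- The largest singular value of a square real matrix (singular values are those of the
associated linear map of Euclidean spaces, listed with multiplicity in decreasing order). -/
def sigmaMax {ι : Type*} [Fintype ι] [DecidableEq ι] (A : Matrix ι ι ℝ) : ℝ :=
  (Matrix.toEuclideanLin A).singularValues 0

/-- The smallest singular value of a square real matrix: the last of the `card ι` values. -/
def sigmaMin {ι : Type*} [Fintype ι] [DecidableEq ι] (A : Matrix ι ι ℝ) : ℝ :=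
  (Matrix.toEuclideanLin A).singularValues (Fintype.card ι - 1)

/-- The (spectral) condition number `σ_max / σ_min` of a square real matrix. -/
def condNumber {ι : Type*} [Fintype ι] [DecidableEq ι] (A : Matrix ι ι ℝ) : ℝ :=
  sigmaMax A / sigmaMin A

end

/-! With `θ = πx/T` and `y = cos θ`, the cosine part of a coefficient vector is `p(y)` and the sine
part is `q(y) sin θ`, where `p` and `q` have degree at most `N`; the nodes become the Chebyshev
nodes of `[c, 1]`, and their symmetry decouples the two parts (`dataSq`). Discrete orthogonality
bounds the coefficients by samples at the Chebyshev angles of the full interval `[-1, 1]`. So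
`σ_min` measures how large a polynomial can be on `[-1, 1]` when it is small on `[c, 1]`. The affine
map of `[c, 1]` onto `[-1, 1]` sends `-1` to `-(E + 1/E)/2`, hence the growth `E^N`
(`sq_eval_le_sum_chebNode`); the Chebyshev polynomial of `[c, 1]` attains it up to powers of `N`
(`exists_coeffs_dataSq_le`).

The bounds uniform in `T` are crude in powers of `N`. For `κ = O(E^N)` at fixed `T` these powers
have to cancel. Extremal growth occurs only near `-1`, at about `√N` of the `N` sample points, so
`σ_min²` is at least of order `√N E^(-2N)` (`exists_sum_sq_eval_cos_le`). The angles `θ` cluster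
quadratically at the end `y = c`, about `√N` of them in a window of length `1/N`, so a large sieve
gives `σ_max²` of order at most `√N` (`exists_dataSq_le`). The two factors cancel in the quotient.
The limit of `κ^(1/N)` then follows by squeezing. -/

/-! ### A Cauchy kernel sum -/

-- Terms with `j ≤ ⌊R⌋` are at most `1`, and the tail is at most `R² ∑ j⁻²`. With `R` of order `√N`
-- this is the source of both `√N` factors.
open Finset in
theorem sum_sq_div_sq_add_sq_le {R : ℝ} (hR : 1 ≤ R) (n : ℕ) :
    ∑ j ∈ range n, R ^ 2 / (R ^ 2 + (j : ℝ) ^ 2) ≤ 4 * R := by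
  set k := ⌊R⌋₊ with hk
  have hk1 : (k : ℝ) ≤ R := Nat.floor_le (by linarith)
  have hk2 : R < k + 1 := Nat.lt_floor_add_one R
  have hterm : ∀ j ∈ range n, R ^ 2 / (R ^ 2 + (j : ℝ) ^ 2) ≤
      (if j ∈ range (k + 1) then (1 : ℝ) else 0) +
        R ^ 2 * (if j ∈ Ioo k n then ((j : ℝ) ^ 2)⁻¹ else 0) := by
    intro j hj
    rw [mem_range] at hj
    by_cases h : j < k + 1
    · have : ¬ (k < j ∧ j < n) := by omega
      simp only [mem_range, h, mem_Ioo, this, if_true, if_false]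
      rw [mul_zero, add_zero, div_le_one (by positivity)]
      nlinarith [sq_nonneg (j : ℝ)]
    · have h' : k < j ∧ j < n := by omega
      have hj0 : (0 : ℝ) < j := by exact_mod_cast (by omega : 0 < j)
      simp only [mem_range, h, mem_Ioo, h', if_true, if_false, and_self]
      rw [zero_add, ← div_eq_mul_inv]
      gcongr
      nlinarith
  refine (sum_le_sum hterm).trans ?_
  rw [sum_add_distrib, ← mul_sum, sum_ite_mem, sum_ite_mem]
  have h1 : ∑ i ∈ range n ∩ range (k + 1), (1 : ℝ) ≤ k + 1 := by
    rw [sum_const, nsmul_eq_mul, mul_one]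
    have := card_le_card (inter_subset_right (s₁ := range n) (s₂ := range (k + 1)))
    rw [card_range] at this
    exact_mod_cast this
  have h2 : ∑ i ∈ range n ∩ Ioo k n, ((i : ℝ) ^ 2)⁻¹ ≤ 2 / (k + 1) :=
    (sum_le_sum_of_subset_of_nonneg inter_subset_right (fun _ _ _ => by positivity)).trans
      (sum_Ioo_inv_sq_le k n)
  have h3 : R ^ 2 * (2 / (k + 1)) ≤ 2 * R := by
    rw [mul_div_assoc', div_le_iff₀ (by positivity)]
    nlinarith
  nlinarith [mul_le_mul_of_nonneg_left h2 (sq_nonneg R)]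

/-! ### Discrete orthogonality at the Chebyshev angles -/

/-- The angle `(2n+1)π / (2N+2)` of the `n`-th Chebyshev node. -/
noncomputable def chebAngle (N n : ℕ) : ℝ := (2 * n + 1) * Real.pi / (2 * N + 2)

theorem chebAngle_pos (N n : ℕ) : 0 < chebAngle N n := by
  unfold chebAngle; positivity

theorem chebAngle_lt_pi {N n : ℕ} (h : n < N + 1) : chebAngle N n < Real.pi := by
  unfold chebAngle
  have : (n : ℝ) + 1 ≤ N + 1 := by exact_mod_cast h
  rw [div_lt_iff₀ (by positivity)]
  nlinarith [Real.pi_pos]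

-- The angles are in arithmetic progression, so multiplying by twice the sine of the half step `h`
-- telescopes the sum to `sin (kπ) = 0`. The bound on `|k|` keeps `sin h` nonzero.
open Finset in
theorem sum_cos_int_mul_chebAngle {N : ℕ} {k : ℤ} (hk : k ≠ 0) (hk' : |k| < 2 * N + 2) :
    ∑ j ∈ range (N + 1), Real.cos (k * chebAngle N j) = 0 := by
  set h : ℝ := k * (Real.pi / (2 * N + 2)) with hh
  have hs : Real.sin h ≠ 0 := by
    rw [abs_lt] at hk'
    have h1 : -(2 * (N : ℝ) + 2) < k := by exact_mod_cast hk'.1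
    have h2 : (k : ℝ) < 2 * N + 2 := by exact_mod_cast hk'.2
    intro h0
    have hp := Real.pi_pos
    have hd : (0 : ℝ) < 2 * N + 2 := by positivity
    rw [Real.sin_eq_zero_iff_of_lt_of_lt] at h0
    · have : (k : ℝ) ≠ 0 := by exact_mod_cast hk
      exact (mul_ne_zero this (by positivity)) (hh ▸ h0)
    · rw [hh, mul_div_assoc', lt_div_iff₀ hd]; nlinarith
    · rw [hh, mul_div_assoc', div_lt_iff₀ hd]; nlinarith
  have ht : ∀ j, 2 * Real.sin h * Real.cos (k * chebAngle N j) =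
      Real.sin (2 * (j + 1 : ℕ) * h) - Real.sin (2 * (j : ℕ) * h) := by
    intro j
    have e : k * chebAngle N j = (2 * j + 1) * h := by rw [hh, chebAngle]; ring
    rw [e, Real.sin_sub_sin]
    push_cast
    congr 2 <;> [congr 1; skip] <;> ring
  have hz : 2 * Real.sin h * ∑ j ∈ range (N + 1), Real.cos (k * chebAngle N j) = 0 := by
    rw [mul_sum, sum_congr rfl (fun j _ => ht j),
      sum_range_sub (fun j : ℕ => Real.sin (2 * (j : ℝ) * h))]
    have : 2 * ((N + 1 : ℕ) : ℝ) * h = k * Real.pi := by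
      rw [hh]; push_cast; field_simp
    rw [this, Real.sin_int_mul_pi]
    simp
  exact (mul_eq_zero.mp hz).resolve_left (by simpa using hs)

open Finset in
theorem mul_sum_sq_le_of_orthogonal {M N : ℕ} {f : ℕ → ℕ → ℝ} {L : ℝ}
    (h0 : ∀ k < M, ∀ l < M, k ≠ l → ∑ j ∈ range N, f k j * f l j = 0)
    (hL : ∀ k < M, L ≤ ∑ j ∈ range N, f k j ^ 2) (a : ℕ → ℝ) :
    L * ∑ k ∈ range M, a k ^ 2 ≤ ∑ j ∈ range N, (∑ k ∈ range M, a k * f k j) ^ 2 := by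
  have e : ∑ j ∈ range N, (∑ k ∈ range M, a k * f k j) ^ 2 =
      ∑ k ∈ range M, a k ^ 2 * ∑ j ∈ range N, f k j ^ 2 := by
    simp_rw [sq (∑ k ∈ range M, _), sum_mul_sum]
    rw [sum_comm]
    refine sum_congr rfl fun k hk => ?_
    rw [sum_comm, sum_eq_single_of_mem k hk]
    · rw [mul_sum]; exact sum_congr rfl fun _ _ => by ring
    · intro l hl hlk
      have := h0 k (mem_range.mp hk) l (mem_range.mp hl) (Ne.symm hlk)
      calc _ = a k * a l * ∑ j ∈ range N, f k j * f l j := by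
            rw [mul_sum]; exact sum_congr rfl fun _ _ => by ring
        _ = 0 := by rw [this, mul_zero]
  rw [e, mul_sum]
  refine sum_le_sum fun k hk => ?_
  rw [mul_comm]
  exact mul_le_mul_of_nonneg_left (hL k (mem_range.mp hk)) (sq_nonneg _)

open Finset in
theorem sum_cos_nat_mul_cos_nat (N k l : ℕ) :
    ∑ j ∈ range (N + 1), Real.cos (k * chebAngle N j) * Real.cos (l * chebAngle N j) =
      (∑ j ∈ range (N + 1), Real.cos (((k - l : ℤ) : ℝ) * chebAngle N j) +
        ∑ j ∈ range (N + 1), Real.cos (((k + l : ℤ) : ℝ) * chebAngle N j)) / 2 := by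
  rw [← sum_add_distrib, sum_div]
  refine sum_congr rfl fun j _ => ?_
  push_cast
  rw [sub_mul, add_mul, Real.cos_sub, Real.cos_add]
  ring

open Finset in
theorem sum_sin_mul_sin (N : ℕ) (x y : ℝ) (m n : ℤ) (hm : x - y = m) (hn : x + y = n) :
    ∑ j ∈ range (N + 1), Real.sin (x * chebAngle N j) * Real.sin (y * chebAngle N j) =
      (∑ j ∈ range (N + 1), Real.cos (m * chebAngle N j) -
        ∑ j ∈ range (N + 1), Real.cos (n * chebAngle N j)) / 2 := by
  rw [← sum_sub_distrib, sum_div]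
  refine sum_congr rfl fun j _ => ?_
  rw [← hm, ← hn, sub_mul, add_mul, Real.cos_sub, Real.cos_add]
  ring

open Finset in
theorem sum_sq_cos_series_ge (N : ℕ) (a : ℕ → ℝ) :
    (N + 1) / 2 * ∑ k ∈ range (N + 1), a k ^ 2 ≤
      ∑ j ∈ range (N + 1), (∑ k ∈ range (N + 1), a k * Real.cos (k * chebAngle N j)) ^ 2 := by
  refine mul_sum_sq_le_of_orthogonal (f := fun k j => Real.cos (k * chebAngle N j)) ?_ ?_ a
  · intro k hk l hl hkl
    rw [sum_cos_nat_mul_cos_nat, sum_cos_int_mul_chebAngle, sum_cos_int_mul_chebAngle]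
    · simp
    · omega
    · rw [abs_lt]; omega
    · omega
    · rw [abs_lt]; omega
  · intro k hk
    simp_rw [sq]
    rw [sum_cos_nat_mul_cos_nat]
    by_cases hk0 : k = 0
    · subst hk0
      simp
      linarith
    · rw [sum_cos_int_mul_chebAngle (k := k + k)]
      · simp
      · omega
      · rw [abs_lt]; omega

open Finset in
theorem sum_cos_two_mul_add_two (N : ℕ) :
    ∑ j ∈ range (N + 1), Real.cos (((2 * N + 2 : ℕ) : ℤ) * chebAngle N j) ≤ 0 := by
  refine sum_nonpos fun j _ => ?_
  have : (((2 * N + 2 : ℕ) : ℤ) : ℝ) * chebAngle N j = j * (2 * Real.pi) + Real.pi := by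
    rw [chebAngle]; push_cast; field_simp
  rw [this, add_comm, Real.cos_add_nat_mul_two_pi, Real.cos_pi]
  norm_num

open Finset in
theorem sum_sq_sin_series_ge (N : ℕ) (a : ℕ → ℝ) :
    (N + 1) / 2 * ∑ k ∈ range (N + 1), a k ^ 2 ≤
      ∑ j ∈ range (N + 1),
        (∑ k ∈ range (N + 1), a k * Real.sin ((k + 1) * chebAngle N j)) ^ 2 := by
  refine mul_sum_sq_le_of_orthogonal (f := fun k j => Real.sin ((k + 1) * chebAngle N j)) ?_ ?_ a
  · intro k hk l hl hkl
    rw [sum_sin_mul_sin N _ _ (k - l) (k + l + 2) (by push_cast; ring) (by push_cast; ring),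
      sum_cos_int_mul_chebAngle, sum_cos_int_mul_chebAngle]
    · simp
    · omega
    · rw [abs_lt]; omega
    · omega
    · rw [abs_lt]; omega
  · intro k hk
    simp_rw [sq]
    rw [sum_sin_mul_sin N _ _ 0 ((2 * k + 2 : ℕ) : ℤ) (by push_cast; ring) (by push_cast; ring)]
    have : ∑ j ∈ range (N + 1), Real.cos (((2 * k + 2 : ℕ) : ℤ) * chebAngle N j) ≤ 0 := by
      -- At `k = N` the frequency `2N + 2` aliases and every cosine is `-1`; the sum enters with a
      -- minus sign, so this only enlarges the norm.
      by_cases hkN : k = N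
      · rw [hkN]; exact sum_cos_two_mul_add_two N
      · rw [sum_cos_int_mul_chebAngle]
        · omega
        · rw [abs_lt]; omega
    simp only [Int.cast_zero, zero_mul, Real.cos_zero, sum_const, card_range, nsmul_eq_mul,
      mul_one]
    push_cast at this ⊢
    linarith

-- This is orthogonality of the Dirichlet polynomials for the weight `sin² (α / 2)`. The frequencies
-- stay below `2N + 2`, so no aliasing occurs.
open Finset in
theorem sum_sq_half_sin_series_ge (N : ℕ) (a : ℕ → ℝ) :
    (N + 1) / 2 * ∑ k ∈ range (N + 1), a k ^ 2 ≤
      ∑ j ∈ range (N + 1),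
        (∑ k ∈ range (N + 1), a k * Real.sin ((k + 1 / 2) * chebAngle N j)) ^ 2 := by
  refine mul_sum_sq_le_of_orthogonal
    (f := fun k j => Real.sin ((k + 1 / 2) * chebAngle N j)) ?_ ?_ a
  · intro k hk l hl hkl
    rw [sum_sin_mul_sin N _ _ (k - l) (k + l + 1) (by push_cast; ring) (by push_cast; ring),
      sum_cos_int_mul_chebAngle, sum_cos_int_mul_chebAngle]
    · simp
    · omega
    · rw [abs_lt]; omega
    · omega
    · rw [abs_lt]; omega
  · intro k hk
    simp_rw [sq]
    rw [sum_sin_mul_sin N _ _ 0 (2 * k + 1) (by push_cast; ring) (by push_cast; ring),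
      sum_cos_int_mul_chebAngle (k := 2 * k + 1)]
    · simp
    · omega
    · rw [abs_lt]; omega
-- Growth of Chebyshev and Dirichlet polynomials outside `[-1, 1]`
-- For `|s| = cosh u ≥ 1`, monotonicity of `cosh` gives `e^u ≤ r`, and `T_k (cosh u) = cosh (k u) ≤
-- e^(k u)`.
open Polynomial in
theorem abs_eval_chebyshevT_le_pow {r s : ℝ} (hr : 1 ≤ r) (hs : |s| ≤ (r + r⁻¹) / 2) (k : ℕ) :
    |(Chebyshev.T ℝ k).eval s| ≤ r ^ k := by
  rcases le_total |s| 1 with h | h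
  · exact (Chebyshev.abs_eval_T_real_le_one k h).trans (one_le_pow₀ hr)
  have habs : |(Chebyshev.T ℝ k).eval s| = |(Chebyshev.T ℝ k).eval (abs s)| := by
    rcases abs_choice s with e | e
    · rw [e]
    · rw [e, Chebyshev.T_eval_neg, abs_mul]
      rcases Int.even_or_odd (k : ℤ) with hk | hk
      · simp [Int.negOnePow_even _ hk]
      · simp [Int.negOnePow_odd _ hk]
  have hr0 : 0 < r := by linarith
  have hc : Real.cosh (Real.arcosh |s|) = |s| := Real.cosh_arcosh h
  have hu : 0 ≤ Real.arcosh |s| := Real.arcosh_nonneg h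
  have hle : Real.arcosh |s| ≤ Real.log r := by
    have h1 : Real.cosh (Real.arcosh |s|) ≤ Real.cosh (Real.log r) := by
      rw [hc, Real.cosh_log hr0]; exact hs
    rw [Real.cosh_le_cosh, abs_of_nonneg hu, abs_of_nonneg (Real.log_nonneg hr)] at h1
    exact h1
  rw [habs, ← hc, Chebyshev.T_real_cosh, abs_of_pos (Real.cosh_pos _)]
  have h2 : Real.cosh (((k : ℤ) : ℝ) * Real.arcosh |s|) ≤
      Real.exp (((k : ℤ) : ℝ) * Real.arcosh |s|) := by
    rw [Real.cosh_eq]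
    have : Real.exp (-(((k : ℤ) : ℝ) * Real.arcosh |s|)) ≤
        Real.exp (((k : ℤ) : ℝ) * Real.arcosh |s|) := by
      apply Real.exp_le_exp.mpr
      have : 0 ≤ ((k : ℤ) : ℝ) * Real.arcosh |s| := by push_cast; positivity
      linarith
    linarith
  refine h2.trans ?_
  rw [Int.cast_natCast, Real.exp_nat_mul]
  refine pow_le_pow_left₀ (Real.exp_pos _).le ?_ k
  calc _ ≤ Real.exp (Real.log r) := Real.exp_le_exp.mpr hle
    _ = r := Real.exp_log hr0

open Polynomial in
theorem pow_div_two_le_eval_chebyshevT {r : ℝ} (hr : 1 ≤ r) (k : ℕ) :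
    r ^ k / 2 ≤ (Chebyshev.T ℝ k).eval ((r + r⁻¹) / 2) := by
  have hr0 : 0 < r := by linarith
  rw [← Real.cosh_log hr0, Chebyshev.T_real_cosh, Real.cosh_eq, Int.cast_natCast,
    Real.exp_nat_mul, Real.exp_log hr0]
  have := Real.exp_pos (-(k * Real.log r))
  linarith

open Polynomial in
/-- The polynomial of degree `k` whose value at `cos α` is `sin ((k + 1/2) α) / sin (α / 2)`. -/
noncomputable def dirichletPoly (k : ℕ) : ℝ[X] :=
  2 * ∑ j ∈ Finset.range (k + 1), Chebyshev.T ℝ j - 1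

open Polynomial in
theorem dirichletPoly_succ (k : ℕ) :
    dirichletPoly (k + 1) = dirichletPoly k + 2 * Chebyshev.T ℝ ((k + 1 : ℕ) : ℤ) := by
  rw [dirichletPoly, dirichletPoly, Finset.sum_range_succ _ (k + 1)]
  ring

open Polynomial in
theorem degree_two_mul_chebyshevT (k : ℕ) :
    (2 * Chebyshev.T ℝ (k : ℤ)).degree = k := by
  rw [degree_mul, Chebyshev.degree_T]
  have : (2 : ℝ[X]) = C 2 := rfl
  rw [this, degree_C (by norm_num)]
  simp

open Polynomial in
theorem degree_dirichletPoly (k : ℕ) : (dirichletPoly k).degree = k := by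
  induction k with
  | zero =>
    have : dirichletPoly 0 = 1 := by simp [dirichletPoly]; ring
    simp [this]
  | succ k ih =>
    rw [dirichletPoly_succ, degree_add_eq_right_of_degree_lt, degree_two_mul_chebyshevT]
    rw [degree_two_mul_chebyshevT, ih]
    exact_mod_cast Nat.lt_succ_self k

open Polynomial in
theorem eval_dirichletPoly_cos_mul_sin (k : ℕ) (α : ℝ) :
    (dirichletPoly k).eval (Real.cos α) * Real.sin (α / 2) = Real.sin ((k + 1 / 2) * α) := by
  induction k with
  | zero =>
    have : dirichletPoly 0 = 1 := by simp [dirichletPoly]; ring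
    simp only [this, eval_one, Nat.cast_zero]
    ring_nf
  | succ k ih =>
    rw [dirichletPoly_succ, eval_add, add_mul, ih, eval_mul, Chebyshev.T_real_cos]
    have e : Real.sin (((k + 1 : ℕ) + 1 / 2 : ℝ) * α) - Real.sin ((k + 1 / 2) * α) =
        2 * Real.sin (α / 2) * Real.cos (((k + 1 : ℕ) : ℝ) * α) := by
      rw [Real.sin_sub_sin]
      push_cast
      congr 2 <;> [congr 1; skip] <;> ring
    have : eval (Real.cos α) (2 : ℝ[X]) = 2 := by simp
    rw [this, Int.cast_natCast]
    linarith

open Finset in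
theorem sum_pow_le_of_one_lt {q₀ q : ℝ} (h0 : 1 < q₀) (hq : q₀ ≤ q) (N : ℕ) :
    ∑ k ∈ range (N + 1), q ^ k ≤ q ^ N * (q₀ / (q₀ - 1)) := by
  have hp : 0 < q₀ - 1 := by linarith
  have hK : q ≤ (q - 1) * (q₀ / (q₀ - 1)) := by
    rw [mul_div_assoc', le_div_iff₀ hp]; nlinarith
  induction N with
  | zero =>
    simp only [zero_add, range_one, sum_singleton, pow_zero, one_mul]
    rw [le_div_iff₀ hp]; linarith
  | succ N ih =>
    rw [sum_range_succ]
    have : 0 < q ^ N := by have : 0 < q := by linarith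
                           positivity
    calc _ ≤ q ^ N * (q₀ / (q₀ - 1)) + q ^ N * q := by rw [← pow_succ]; linarith
      _ ≤ q ^ N * (q₀ / (q₀ - 1)) + q ^ N * ((q - 1) * (q₀ / (q₀ - 1))) := by gcongr
      _ = _ := by rw [pow_succ]; ring

-- The geometric sum of the Chebyshev bounds is dominated by its last term. The constant depends
-- only on the lower bound `r₀`, so `r` may later vary with the evaluation point.
open Polynomial in
theorem abs_eval_dirichletPoly_le {r₀ r s : ℝ} (h0 : 1 < r₀) (hr : r₀ ≤ r)
    (hs : |s| ≤ (r + r⁻¹) / 2) (k : ℕ) :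
    |(dirichletPoly k).eval s| ≤ (2 * (r₀ / (r₀ - 1)) + 1) * r ^ k := by
  have h1 : (dirichletPoly k).eval s =
      2 * (∑ j ∈ Finset.range (k + 1), (Chebyshev.T ℝ j).eval s) - 1 := by
    simp [dirichletPoly, eval_finsetSum]
  have h2 : |∑ j ∈ Finset.range (k + 1), (Chebyshev.T ℝ j).eval s| ≤ r ^ k * (r₀ / (r₀ - 1)) :=
    (Finset.abs_sum_le_sum_abs _ _).trans
      ((Finset.sum_le_sum fun j _ => abs_eval_chebyshevT_le_pow (by linarith) hs j).trans
        (sum_pow_le_of_one_lt h0 hr k))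
  have h3 : 1 ≤ r ^ k := one_le_pow₀ (by linarith)
  rw [h1]
  refine (abs_sub _ _).trans ?_
  rw [abs_mul, abs_one, abs_two]
  linarith

open Polynomial in
theorem Polynomial.Sequence.exists_eq_sum (S : Polynomial.Sequence ℝ) {p : ℝ[X]} {N : ℕ}
    (hp : p.natDegree ≤ N) :
    ∃ b : ℕ → ℝ, ∀ t, p.eval t = ∑ k ∈ Finset.range (N + 1), b k * (S k).eval t := by
  have h1 : p ∈ Submodule.span ℝ (S '' Set.Iic N) := by
    rw [S.span_degreeLE fun i _ => isUnit_iff_ne_zero.mpr (leadingCoeff_ne_zero.mpr (S.ne_zero i)),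
      mem_degreeLE]
    exact natDegree_le_iff_degree_le.mp hp
  have h2 : (Set.Iic N : Set ℕ) = (Finset.range (N + 1) : Finset ℕ) := by
    ext x; simp
  rw [h2, Submodule.mem_span_image_finset_iff_exists_fun'] at h1
  obtain ⟨b, hb⟩ := h1
  refine ⟨b, fun t => ?_⟩
  rw [← hb, eval_finsetSum]
  simp

open Polynomial in
/-- The sequence of the polynomials `dirichletPoly`. -/
noncomputable def dirichletSequence : Polynomial.Sequence ℝ where
  elems' := dirichletPoly
  degree_eq' := degree_dirichletPoly

open Polynomial in
theorem natDegree_comp_affine_le {p : ℝ[X]} {N : ℕ} (hp : p.natDegree ≤ N) (a b : ℝ) :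
    (p.comp (C a * X + C b)).natDegree ≤ N := by
  refine natDegree_comp_le.trans ?_
  calc _ ≤ p.natDegree * 1 := Nat.mul_le_mul_left _ natDegree_linear_le
    _ ≤ N := by omega

/-! ### Extrapolation from `[c, 1]` to `[-1, 1]` -/

/-- The `n`-th Chebyshev node mapped to `[c, 1]`. -/
noncomputable def chebNode (c : ℝ) (N n : ℕ) : ℝ :=
  (1 - c) / 2 * Real.cos (chebAngle N n) + (1 + c) / 2

open Polynomial in
theorem exists_eval_affine_eq_sum (S : Polynomial.Sequence ℝ) {p : ℝ[X]} {N : ℕ}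
    (hp : p.natDegree ≤ N) (c : ℝ) :
    ∃ b : ℕ → ℝ, ∀ t, p.eval ((1 - c) / 2 * t + (1 + c) / 2) =
      ∑ k ∈ Finset.range (N + 1), b k * (S k).eval t := by
  obtain ⟨b, hb⟩ := S.exists_eq_sum (natDegree_comp_affine_le hp ((1 - c) / 2) ((1 + c) / 2))
  exact ⟨b, fun t => by rw [← hb t]; simp⟩

open Polynomial in
/-- A polynomial of degree `N` on `[-1, 1]` is bounded by its values at the Chebyshev nodes of
`[c, 1]`, with the growth factor of the Bernstein ellipse through `-1`. -/
theorem sq_eval_le_sum_chebNode {c E : ℝ} (hc : c < 1) (hE : 1 ≤ E)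
    (hcE : (E + E⁻¹) / 2 = (3 + c) / (1 - c)) {p : ℝ[X]} {N : ℕ} (hp : p.natDegree ≤ N) {y : ℝ}
    (hy : -1 ≤ y) (hy' : y ≤ 1) :
    p.eval y ^ 2 ≤ 2 * E ^ (2 * N) * ∑ n ∈ Finset.range (N + 1), p.eval (chebNode c N n) ^ 2 := by
  obtain ⟨b, hb⟩ := exists_eval_affine_eq_sum (Chebyshev.chebyshevTsequence ℝ) hp c
  have hT : ∀ k : ℕ, Chebyshev.chebyshevTsequence ℝ k = Chebyshev.T ℝ k := fun _ => rfl
  simp_rw [hT] at hb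
  have hd : 0 < 1 - c := by linarith
  set s : ℝ := (2 * y - (1 + c)) / (1 - c) with hs
  have hys : y = (1 - c) / 2 * s + (1 + c) / 2 := by rw [hs]; field_simp; ring
  have hs1 : |s| ≤ (E + E⁻¹) / 2 := by
    rw [hcE, hs, abs_le, ← neg_div]
    constructor
    · gcongr; linarith
    · gcongr
      have : 1 ≤ (E + E⁻¹) / 2 := by
        have h0 : 0 < E := by linarith
        have : E * E⁻¹ = 1 := mul_inv_cancel₀ h0.ne'
        nlinarith [sq_nonneg (E - 1), inv_pos.mpr h0]
      rw [hcE, le_div_iff₀ hd] at this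
      linarith
  have h1 : |p.eval y| ≤ ∑ k ∈ Finset.range (N + 1), |b k| * E ^ N := by
    rw [hys, hb]
    refine (Finset.abs_sum_le_sum_abs _ _).trans (Finset.sum_le_sum fun k hk => ?_)
    rw [abs_mul]
    gcongr
    exact (abs_eval_chebyshevT_le_pow hE hs1 k).trans
      (pow_le_pow_right₀ hE (Nat.lt_succ_iff.mp (Finset.mem_range.mp hk)))
  -- At the nodes the affine variable is `cos (chebAngle N n)`, so discrete orthogonality controls
  -- the coefficients `b`.
  have h2 : (N + 1) / 2 * ∑ k ∈ Finset.range (N + 1), b k ^ 2 ≤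
      ∑ n ∈ Finset.range (N + 1), p.eval (chebNode c N n) ^ 2 := by
    refine (sum_sq_cos_series_ge N b).trans (le_of_eq (Finset.sum_congr rfl fun n _ => ?_))
    rw [chebNode, hb]
    simp [Chebyshev.T_real_cos]
  have h3 : (∑ k ∈ Finset.range (N + 1), |b k|) ^ 2 ≤
      (N + 1) * ∑ k ∈ Finset.range (N + 1), b k ^ 2 := by
    refine sq_sum_le_card_mul_sum_sq.trans (le_of_eq ?_)
    simp
  rw [← Finset.sum_mul] at h1
  calc p.eval y ^ 2 = |p.eval y| ^ 2 := (sq_abs _).symm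
    _ ≤ ((∑ k ∈ Finset.range (N + 1), |b k|) * E ^ N) ^ 2 := by gcongr
    _ = (∑ k ∈ Finset.range (N + 1), |b k|) ^ 2 * E ^ (2 * N) := by rw [mul_pow]; ring
    _ ≤ (2 * ∑ n ∈ Finset.range (N + 1), p.eval (chebNode c N n) ^ 2) * E ^ (2 * N) := by
        gcongr; linarith
    _ = _ := by ring

open Finset in
theorem sq_sum_mul_le_of_geometric {B r₀ r : ℝ} (h0 : 1 < r₀) (hr : r₀ ≤ r)
    {N : ℕ} {F : ℕ → ℝ} (hF : ∀ k, |F k| ≤ B * r ^ k) (b : ℕ → ℝ) :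
    (∑ k ∈ range (N + 1), b k * F k) ^ 2 ≤
      (∑ k ∈ range (N + 1), b k ^ 2) * (B ^ 2 * (r ^ (2 * N) * (r₀ ^ 2 / (r₀ ^ 2 - 1)))) := by
  refine (sum_mul_sq_le_sq_mul_sq _ _ _).trans ?_
  refine mul_le_mul_of_nonneg_left ?_ (sum_nonneg fun _ _ => sq_nonneg _)
  calc ∑ k ∈ range (N + 1), F k ^ 2 ≤ ∑ k ∈ range (N + 1), B ^ 2 * (r ^ 2) ^ k := by
        refine sum_le_sum fun k _ => ?_
        calc F k ^ 2 = |F k| ^ 2 := (sq_abs _).symm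
          _ ≤ (B * r ^ k) ^ 2 := by gcongr; exact hF k
          _ = _ := by rw [mul_pow]; ring
    _ = B ^ 2 * ∑ k ∈ range (N + 1), (r ^ 2) ^ k := by rw [mul_sum]
    _ ≤ _ := by
        rw [pow_mul]
        exact mul_le_mul_of_nonneg_left
          (sum_pow_le_of_one_lt (by nlinarith) (by nlinarith) N) (sq_nonneg _)

-- With `w = (1 + cos α) / 2`, reflected so that `w ≥ (j / (N + 1))²`, the summand behaves like `exp
-- (-2 N η w)`: only about `√(N / η)` indices contribute. Bernoulli's inequality replaces the
-- exponential by a Cauchy kernel.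
open Finset in
theorem sum_one_sub_pow_le {η : ℝ} (h0 : 0 < η) (h1 : η ≤ 1) {N : ℕ} (hN : 1 ≤ N) :
    ∑ j ∈ range (N + 1), (1 - η * ((1 + Real.cos (chebAngle N j)) / 2)) ^ (2 * N) ≤
      4 * √((N + 1) / η) := by
  set R := √((N + 1) / η) with hR
  have hR2 : R ^ 2 = (N + 1) / η := Real.sq_sqrt (by positivity)
  have hR1 : 1 ≤ R := by
    rw [hR, Real.one_le_sqrt, le_div_iff₀ h0]
    have : (0 : ℝ) ≤ N := by positivity
    linarith
  refine le_trans ?_ (sum_sq_div_sq_add_sq_le hR1 (N + 1))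
  rw [← sum_range_reflect]
  refine sum_le_sum fun j hj => ?_
  have hjN : j ≤ N := Nat.lt_succ_iff.mp (mem_range.mp hj)
  have hrefl : chebAngle N (N + 1 - 1 - j) = Real.pi - chebAngle N j := by
    rw [chebAngle, chebAngle, Nat.add_sub_cancel, Nat.cast_sub hjN]
    field_simp
    ring
  set w : ℝ := (1 - Real.cos (chebAngle N j)) / 2 with hw
  have hα := chebAngle_pos N j
  have hα' := chebAngle_lt_pi (mem_range.mp hj)
  have hw1 : w ≤ 1 := by have := Real.neg_one_le_cos (chebAngle N j); rw [hw]; linarith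
  have hjw : (j / (N + 1) : ℝ) ^ 2 ≤ w := by
    have hsin : w = Real.sin (chebAngle N j / 2) ^ 2 := by
      rw [hw, Real.sin_sq_eq_half_sub]
      ring_nf
    rw [hsin]
    have h2 : 2 / Real.pi * (chebAngle N j / 2) ≤ Real.sin (chebAngle N j / 2) :=
      Real.mul_le_sin (by positivity) (by linarith)
    refine pow_le_pow_left₀ (by positivity) (le_trans ?_ h2) 2
    have : 2 / Real.pi * (chebAngle N j / 2) = (2 * j + 1) / (2 * N + 2) := by
      have := Real.pi_pos
      rw [chebAngle]; field_simp
    rw [this, div_le_div_iff₀ (by positivity) (by positivity)]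
    have : (0 : ℝ) ≤ N := by positivity
    nlinarith
  have hw0 : 0 ≤ w := le_trans (by positivity) hjw
  rw [hrefl, Real.cos_pi_sub, ← sub_eq_add_neg, ← hw]
  have hx0 : 0 ≤ η * w := by positivity
  have hx1 : η * w ≤ 1 := by nlinarith
  have hb : 1 + (2 * N : ℕ) * (η * w) ≤ (1 + η * w) ^ (2 * N) :=
    one_add_mul_le_pow (by linarith) _
  have hprod : (1 - η * w) ^ (2 * N) * (1 + η * w) ^ (2 * N) ≤ 1 := by
    rw [← mul_pow]
    exact pow_le_one₀ (by nlinarith) (by nlinarith)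
  have hpos : 0 ≤ (1 - η * w) ^ (2 * N) := pow_nonneg (by linarith) _
  have hmain : (1 - η * w) ^ (2 * N) * (1 + 2 * N * (η * w)) ≤ 1 := by
    push_cast at hb
    exact (mul_le_mul_of_nonneg_left hb hpos).trans hprod
  rw [le_div_iff₀ (by positivity)]
  have hN1 : (1 : ℝ) ≤ N := by exact_mod_cast hN
  -- This needs `N + 1 ≤ 2N`, which is where `1 ≤ N` enters.
  have hj2 : (j : ℝ) ^ 2 ≤ R ^ 2 * (2 * N * (η * w)) := by
    have : R ^ 2 * (2 * N * (η * w)) = (N + 1) * (2 * N) * w := by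
      rw [hR2]; field_simp
    rw [this]
    rw [div_pow, div_le_iff₀ (by positivity)] at hjw
    nlinarith
  nlinarith [mul_le_mul_of_nonneg_left hj2 hpos, mul_le_mul_of_nonneg_left hmain (sq_nonneg R)]

/-- The decreasing radius `E - λ w` of a Bernstein ellipse dominates the affine image of
`-1 + 2 w`. -/
theorem abs_affine_le_joukowski {c E w : ℝ} (hc : -1 < c) (hc' : c < 1) (hE : 1 < E)
    (hcE : (E + E⁻¹) / 2 = (3 + c) / (1 - c)) (hw : 0 ≤ w) (hw' : w ≤ 1) {r : ℝ}
    (hr : r = E * (1 - (E - 1) / (2 * E ^ 2) * w)) :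
    (E + 1) / 2 ≤ r ∧ |(2 * (2 * w - 1) - (1 + c)) / (1 - c)| ≤ (r + r⁻¹) / 2 := by
  have hE0 : 0 < E := by linarith
  set l : ℝ := (E - 1) / (2 * E) with hl
  have hl0 : 0 < l := by rw [hl]; exact div_pos (by linarith) (by linarith)
  have hl1 : l ≤ 1 / 2 := by rw [hl, div_le_iff₀ (by linarith)]; linarith
  have hl2 : l ≤ (E - 1) / 2 := by
    rw [hl, div_le_div_iff₀ (by linarith) (by norm_num)]; nlinarith
  have hr' : r = E - l * w := by rw [hr, hl]; field_simp
  have hlw : l * w ≤ l := by nlinarith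
  have hlw0 : 0 ≤ l * w := by positivity
  have hr0 : (E + 1) / 2 ≤ r := by rw [hr']; linarith
  have hrpos : 0 < r := by linarith
  refine ⟨hr0, ?_⟩
  have hone : 1 ≤ (r + r⁻¹) / 2 := by
    have : r * r⁻¹ = 1 := mul_inv_cancel₀ hrpos.ne'
    nlinarith [sq_nonneg (r - 1), inv_pos.mpr hrpos]
  have hd : 0 < 1 - c := by linarith
  have hinv : E⁻¹ ≤ r⁻¹ := inv_anti₀ hrpos (by linarith)
  rw [abs_le]
  constructor
  -- The image point moves inward by at least `2 w`, while lowering the radius by `l w` lowers the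
  -- half-sum by at most `l w / 2`.
  · have e : (2 * (2 * w - 1) - (1 + c)) / (1 - c) = -((3 + c) / (1 - c)) + 4 * w / (1 - c) := by
      field_simp; ring
    have h2 : 2 * w ≤ 4 * w / (1 - c) := by
      rw [le_div_iff₀ hd]; nlinarith
    rw [e, ← hcE]
    nlinarith
  · refine le_trans ?_ hone
    rw [div_le_one hd]; linarith

open Polynomial in
/-- For fixed `c`, the mean square over the Chebyshev nodes of `[-1, 1]` of a polynomial gains a
factor `N ^ (-1/2)` over the pointwise bound, since the growth is concentrated near `-1`. -/
theorem exists_sum_sq_eval_cos_le {c E : ℝ} (hc : -1 < c) (hc' : c < 1) (hE : 1 < E)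
    (hcE : (E + E⁻¹) / 2 = (3 + c) / (1 - c)) :
    ∃ C : ℝ, 0 < C ∧ ∀ N : ℕ, 1 ≤ N → ∀ p : ℝ[X], p.natDegree ≤ N →
      ∑ j ∈ Finset.range (N + 1), p.eval (Real.cos (chebAngle N j)) ^ 2 ≤
        C * E ^ (2 * N) / √(N + 1) *
          ∑ n ∈ Finset.range (N + 1), p.eval (chebNode c N n) ^ 2 *
            (1 - Real.cos (chebAngle N n)) := by
  set r₀ : ℝ := (E + 1) / 2 with hr₀
  have hr₀1 : 1 < r₀ := by rw [hr₀]; linarith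
  set B : ℝ := 2 * (r₀ / (r₀ - 1)) + 1 with hB
  have hB0 : 0 < B := by
    have : 0 < r₀ / (r₀ - 1) := div_pos (by linarith) (by linarith)
    linarith
  -- The relative rate at which the ellipse radius shrinks away from `-1` in
  -- `abs_affine_le_joukowski`.
  set η : ℝ := (E - 1) / (2 * E ^ 2) with hη
  have hη0 : 0 < η := div_pos (by linarith) (by positivity)
  have hη1 : η ≤ 1 := by rw [hη, div_le_one (by positivity)]; nlinarith
  set K : ℝ := B ^ 2 * (r₀ ^ 2 / (r₀ ^ 2 - 1)) with hK
  have hK0 : 0 < K := by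
    have : 0 < r₀ ^ 2 - 1 := by nlinarith
    have : 0 < r₀ := by linarith
    positivity
  refine ⟨4 * K / √η, by positivity, fun N hN p hp => ?_⟩
  obtain ⟨b, hb⟩ := exists_eval_affine_eq_sum dirichletSequence hp c
  have hT : ∀ k : ℕ, dirichletSequence k = dirichletPoly k := fun _ => rfl
  simp_rw [hT] at hb
  have hd : 0 < 1 - c := by linarith
  -- The sine part is seen only through `1 - y²`, which vanishes at `y = 1`. Expanding in Dirichlet
  -- polynomials gives orthogonality for the matching weight `1 - cos α = 2 sin² (α / 2)`.
  have hcoef : (N + 1) * ∑ k ∈ Finset.range (N + 1), b k ^ 2 ≤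
      ∑ n ∈ Finset.range (N + 1), p.eval (chebNode c N n) ^ 2 *
        (1 - Real.cos (chebAngle N n)) := by
    have h1 := sum_sq_half_sin_series_ge N b
    have h2 : ∑ j ∈ Finset.range (N + 1),
        (∑ k ∈ Finset.range (N + 1), b k * Real.sin ((k + 1 / 2) * chebAngle N j)) ^ 2 =
        (∑ n ∈ Finset.range (N + 1), p.eval (chebNode c N n) ^ 2 *
          (1 - Real.cos (chebAngle N n))) / 2 := by
      rw [Finset.sum_div]
      refine Finset.sum_congr rfl fun n _ => ?_
      have h3 : ∑ k ∈ Finset.range (N + 1), b k * Real.sin ((k + 1 / 2) * chebAngle N n) =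
          p.eval (chebNode c N n) * Real.sin (chebAngle N n / 2) := by
        rw [chebNode, hb, Finset.sum_mul]
        refine Finset.sum_congr rfl fun k _ => ?_
        rw [mul_assoc, eval_dirichletPoly_cos_mul_sin]
      rw [h3, mul_pow, Real.sin_sq_eq_half_sub]
      ring_nf
    rw [h2] at h1
    linarith
  have hpt : ∀ j ∈ Finset.range (N + 1), p.eval (Real.cos (chebAngle N j)) ^ 2 ≤
      (∑ k ∈ Finset.range (N + 1), b k ^ 2) * K * E ^ (2 * N) *
        (1 - η * ((1 + Real.cos (chebAngle N j)) / 2)) ^ (2 * N) := by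
    intro j _
    set y := Real.cos (chebAngle N j) with hy
    have hy1 : -1 ≤ y := Real.neg_one_le_cos _
    have hy2 : y ≤ 1 := Real.cos_le_one _
    obtain ⟨hr, hs⟩ := abs_affine_le_joukowski hc hc' hE hcE (w := (1 + y) / 2) (by linarith)
      (by linarith) rfl
    rw [← hη] at hr hs
    set r := E * (1 - η * ((1 + y) / 2)) with hrdef
    set s := (2 * (2 * ((1 + y) / 2) - 1) - (1 + c)) / (1 - c) with hsdef
    have hys : y = (1 - c) / 2 * s + (1 + c) / 2 := by rw [hsdef]; field_simp; ring
    have h4 := sq_sum_mul_le_of_geometric hr₀1 hr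
      (fun k => abs_eval_dirichletPoly_le hr₀1 hr hs k) b (N := N)
    rw [hys, hb]
    refine h4.trans (le_of_eq ?_)
    rw [← hys, hK, hrdef, mul_pow E]
    ring
  have hS0 : 0 ≤ ∑ k ∈ Finset.range (N + 1), b k ^ 2 := Finset.sum_nonneg fun _ _ => sq_nonneg _
  have hN0 : (0 : ℝ) < N + 1 := by positivity
  have hE0 : 0 < E := by linarith
  have hsq : √((N + 1 : ℝ) / η) = (N + 1) / (√(N + 1) * √η) := by
    rw [Real.sqrt_div' _ hη0.le, div_eq_div_iff (by positivity) (by positivity), ← mul_assoc,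
      Real.mul_self_sqrt hN0.le]
  calc _ ≤ (∑ k ∈ Finset.range (N + 1), b k ^ 2) * K * E ^ (2 * N) *
        ∑ j ∈ Finset.range (N + 1), (1 - η * ((1 + Real.cos (chebAngle N j)) / 2)) ^ (2 * N) := by
        rw [Finset.mul_sum]; exact Finset.sum_le_sum hpt
    _ ≤ (∑ k ∈ Finset.range (N + 1), b k ^ 2) * K * E ^ (2 * N) * (4 * √((N + 1) / η)) := by
        have := sum_one_sub_pow_le hη0 hη1 hN
        gcongr
    _ = 4 * K / √η * E ^ (2 * N) / √(N + 1) *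
          ((N + 1) * ∑ k ∈ Finset.range (N + 1), b k ^ 2) := by
        rw [hsq]; field_simp
    _ ≤ _ := by gcongr

/-! ### The Fejér kernel and a large sieve -/

open Finset in
/-- The modulus squared of the Dirichlet sum `∑_{j < M} e^{ijx}` (an unnormalised Fejér kernel). -/
noncomputable def fejerSum (M : ℕ) (x : ℝ) : ℝ :=
  ∑ i ∈ range M, ∑ j ∈ range M, Real.cos (((i : ℝ) - j) * x)

open Finset in
theorem fejerSum_neg (M : ℕ) (x : ℝ) : fejerSum M (-x) = fejerSum M x := by
  simp [fejerSum]

open Finset in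
theorem fejerSum_le_sq (M : ℕ) (x : ℝ) : fejerSum M x ≤ (M : ℝ) ^ 2 := by
  calc fejerSum M x ≤ ∑ i ∈ range M, ∑ j ∈ range M, (1 : ℝ) :=
        sum_le_sum fun _ _ => sum_le_sum fun _ _ => Real.cos_le_one _
    _ = (M : ℝ) ^ 2 := by simp [sq]

open Finset in
theorem fejerSum_eq (M : ℕ) (x : ℝ) : fejerSum M x =
    (∑ i ∈ range M, Real.cos (i * x)) ^ 2 + (∑ i ∈ range M, Real.sin (i * x)) ^ 2 := by
  rw [sq, sq, sum_mul_sum, sum_mul_sum, ← sum_add_distrib, fejerSum]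
  refine sum_congr rfl fun i _ => ?_
  rw [← sum_add_distrib]
  refine sum_congr rfl fun j _ => ?_
  rw [sub_mul, Real.cos_sub]

open Finset in
theorem fejerSum_nonneg (M : ℕ) (x : ℝ) : 0 ≤ fejerSum M x := by
  rw [fejerSum_eq]; positivity

-- After multiplication by `2 sin (x / 2)` both sums telescope, giving the two coordinates of a
-- difference of unit vectors; its squared length is at most `4`.
open Finset in
theorem fejerSum_mul_sin_sq_le (M : ℕ) (x : ℝ) : fejerSum M x * Real.sin (x / 2) ^ 2 ≤ 1 := by
  have hc : 2 * Real.sin (x / 2) * ∑ i ∈ range M, Real.cos (i * x) =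
      Real.sin ((M - 1 / 2) * x) + Real.sin (x / 2) := by
    have : ∀ i : ℕ, 2 * Real.sin (x / 2) * Real.cos (i * x) =
        Real.sin (((i + 1 : ℕ) - 1 / 2) * x) - Real.sin (((i : ℕ) - 1 / 2) * x) := by
      intro i
      rw [Real.sin_sub_sin]
      push_cast
      congr 2 <;> [congr 1; skip] <;> ring
    rw [mul_sum, sum_congr rfl fun i _ => this i,
      sum_range_sub (fun i : ℕ => Real.sin (((i : ℝ) - 1 / 2) * x))]
    have : ((0 : ℕ) - 1 / 2 : ℝ) * x = -(x / 2) := by push_cast; ring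
    rw [this, Real.sin_neg]; ring
  have hs : 2 * Real.sin (x / 2) * ∑ i ∈ range M, Real.sin (i * x) =
      Real.cos (x / 2) - Real.cos ((M - 1 / 2) * x) := by
    have : ∀ i : ℕ, 2 * Real.sin (x / 2) * Real.sin (i * x) =
        -Real.cos (((i + 1 : ℕ) - 1 / 2) * x) - -Real.cos (((i : ℕ) - 1 / 2) * x) := by
      intro i
      have e1 : (((i + 1 : ℕ) : ℝ) - 1 / 2) * x = i * x + x / 2 := by push_cast; ring
      have e2 : ((i : ℝ) - 1 / 2) * x = i * x - x / 2 := by ring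
      rw [e1, e2, Real.cos_add, Real.cos_sub]
      ring
    rw [mul_sum, sum_congr rfl fun i _ => this i,
      sum_range_sub (fun i : ℕ => -Real.cos (((i : ℝ) - 1 / 2) * x))]
    have : ((0 : ℕ) - 1 / 2 : ℝ) * x = -(x / 2) := by push_cast; ring
    rw [this, Real.cos_neg]; ring
  have h : 4 * (fejerSum M x * Real.sin (x / 2) ^ 2) =
      (2 * Real.sin (x / 2) * ∑ i ∈ range M, Real.cos (i * x)) ^ 2 +
        (2 * Real.sin (x / 2) * ∑ i ∈ range M, Real.sin (i * x)) ^ 2 := by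
    rw [fejerSum_eq]; ring
  rw [hc, hs] at h
  have h1 := Real.sin_sq_add_cos_sq (x / 2)
  have h2 := Real.sin_sq_add_cos_sq ((M - 1 / 2) * x)
  nlinarith [sq_nonneg (Real.sin ((M - 1 / 2) * x) - Real.sin (x / 2)),
    sq_nonneg (Real.cos ((M - 1 / 2) * x) + Real.cos (x / 2))]

-- Schur's test, from `2 v_i v_j ≤ v_i² + v_j²`.
open Finset in
theorem sum_quadratic_le_of_row_sum_le {n : ℕ} {K : ℕ → ℕ → ℝ} (h0 : ∀ i j, 0 ≤ K i j)
    (hsymm : ∀ i j, K i j = K j i) {C : ℝ} (hC : ∀ i < n, ∑ j ∈ range n, K i j ≤ C)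
    (v : ℕ → ℝ) :
    ∑ i ∈ range n, ∑ j ∈ range n, v i * v j * K i j ≤ C * ∑ i ∈ range n, v i ^ 2 := by
  have h1 : ∑ i ∈ range n, ∑ j ∈ range n, v i * v j * K i j ≤
      ∑ i ∈ range n, ∑ j ∈ range n, (v i ^ 2 * K i j / 2 + v j ^ 2 * K i j / 2) := by
    refine sum_le_sum fun i _ => sum_le_sum fun j _ => ?_
    nlinarith [mul_nonneg (sq_nonneg (v i - v j)) (h0 i j)]
  have h2 : ∑ i ∈ range n, ∑ j ∈ range n, v j ^ 2 * K i j / 2 =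
      ∑ i ∈ range n, ∑ j ∈ range n, v i ^ 2 * K i j / 2 := by
    rw [sum_comm]
    exact sum_congr rfl fun i _ => sum_congr rfl fun j _ => by rw [hsymm]
  simp_rw [sum_add_distrib] at h1
  rw [h2, ← mul_two] at h1
  refine h1.trans ?_
  rw [sum_mul, mul_sum]
  refine sum_le_sum fun i hi => ?_
  rw [← sum_div, ← mul_sum]
  nlinarith [mul_le_mul_of_nonneg_left (hC i (mem_range.mp hi)) (sq_nonneg (v i))]

open Finset in
/-- A large sieve inequality: the sums on the left are the trigonometric moments of frequency
less than `Q` of the weights `v` at the points `θ`. -/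
theorem mul_sum_sq_moments_le {n Q : ℕ} {θ : ℕ → ℝ} {C : ℝ}
    (hC : ∀ i < n, ∑ j ∈ range n, fejerSum (2 * Q) (θ i - θ j) ≤ C) (v : ℕ → ℝ) :
    Q * ∑ m ∈ range Q, ((∑ i ∈ range n, v i * Real.cos (m * θ i)) ^ 2 +
      (∑ i ∈ range n, v i * Real.sin (m * θ i)) ^ 2) ≤ C * ∑ i ∈ range n, v i ^ 2 := by
  set g : ℝ → ℝ := fun m => (∑ i ∈ range n, v i * Real.cos (m * θ i)) ^ 2 +
      (∑ i ∈ range n, v i * Real.sin (m * θ i)) ^ 2 with hg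
  have hg0 : ∀ m, 0 ≤ g m := fun m => by rw [hg]; positivity
  have hg1 : ∀ m, g m = ∑ i ∈ range n, ∑ j ∈ range n,
      v i * v j * Real.cos (m * (θ i - θ j)) := by
    intro m
    simp only [hg]
    rw [sq, sq, sum_mul_sum, sum_mul_sum, ← sum_add_distrib]
    refine sum_congr rfl fun i _ => ?_
    rw [← sum_add_distrib]
    refine sum_congr rfl fun j _ => ?_
    rw [mul_sub, Real.cos_sub]; ring
  -- Summing over all differences `a - b` produces the positive kernel `fejerSum`; each frequency `m
  -- < Q` occurs at least `Q` times, once for every `b < Q`.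
  have h1 : ∑ b ∈ range (2 * Q), ∑ a ∈ range (2 * Q), g ((a : ℝ) - b) =
      ∑ i ∈ range n, ∑ j ∈ range n, v i * v j * fejerSum (2 * Q) (θ i - θ j) := by
    simp_rw [hg1, fejerSum, mul_sum]
    rw [sum_comm]
    calc _ = ∑ a ∈ range (2 * Q), ∑ i ∈ range n, ∑ b ∈ range (2 * Q), ∑ j ∈ range n,
          v i * v j * Real.cos (((a : ℝ) - b) * (θ i - θ j)) :=
          sum_congr rfl fun _ _ => sum_comm
      _ = ∑ i ∈ range n, ∑ a ∈ range (2 * Q), ∑ b ∈ range (2 * Q), ∑ j ∈ range n,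
          v i * v j * Real.cos (((a : ℝ) - b) * (θ i - θ j)) := sum_comm
      _ = ∑ i ∈ range n, ∑ a ∈ range (2 * Q), ∑ j ∈ range n, ∑ b ∈ range (2 * Q),
          v i * v j * Real.cos (((a : ℝ) - b) * (θ i - θ j)) :=
          sum_congr rfl fun _ _ => sum_congr rfl fun _ _ => sum_comm
      _ = _ := sum_congr rfl fun _ _ => sum_comm
  have h2 : ∀ b ∈ range Q, ∑ m ∈ range Q, g m ≤ ∑ a ∈ range (2 * Q), g ((a : ℝ) - b) := by
    intro b hb
    rw [mem_range] at hb
    calc ∑ m ∈ range Q, g m = ∑ a ∈ Ico b (b + Q), g ((a : ℝ) - b) := by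
          rw [sum_Ico_eq_sum_range, Nat.add_sub_cancel_left]
          exact sum_congr rfl fun m _ => by push_cast; rw [add_sub_cancel_left]
      _ ≤ _ := by
          refine sum_le_sum_of_subset_of_nonneg (fun x hx => ?_) fun _ _ _ => hg0 _
          rw [mem_Ico] at hx
          rw [mem_range]; omega
  calc (Q : ℝ) * ∑ m ∈ range Q, g m = ∑ b ∈ range Q, ∑ m ∈ range Q, g m := by simp
    _ ≤ ∑ b ∈ range Q, ∑ a ∈ range (2 * Q), g ((a : ℝ) - b) := sum_le_sum h2
    _ ≤ ∑ b ∈ range (2 * Q), ∑ a ∈ range (2 * Q), g ((a : ℝ) - b) :=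
        sum_le_sum_of_subset_of_nonneg (range_mono (by omega))
          fun _ _ _ => sum_nonneg fun _ _ => hg0 _
    _ = _ := h1
    _ ≤ _ := sum_quadratic_le_of_row_sum_le (fun _ _ => fejerSum_nonneg _ _)
        (fun i j => by rw [← fejerSum_neg, neg_sub]) hC v

open Finset in
theorem sum_range_symm_le {f : ℝ → ℝ} (h0 : ∀ x, 0 ≤ f x) (heven : ∀ x, f (-x) = f x) {n i : ℕ}
    (hi : i < n) :
    ∑ j ∈ range n, f ((i : ℝ) - j) ≤ 2 * ∑ j ∈ range n, f j := by
  rw [← sum_range_add_sum_Ico _ (Nat.succ_le_of_lt hi), two_mul]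
  refine add_le_add ?_ ?_
  · rw [← sum_range_reflect]
    refine le_trans (le_of_eq (sum_congr rfl fun j hj => ?_))
      (sum_le_sum_of_subset_of_nonneg (range_mono (Nat.succ_le_of_lt hi)) fun _ _ _ => h0 _)
    have : j ≤ i := Nat.lt_succ_iff.mp (mem_range.mp hj)
    rw [Nat.succ_eq_add_one, Nat.add_sub_cancel, Nat.cast_sub this, sub_sub_cancel]
  · calc ∑ j ∈ Ico i.succ n, f ((i : ℝ) - j) ≤ ∑ j ∈ Ico i n, f ((i : ℝ) - j) :=
          sum_le_sum_of_subset_of_nonneg (Ico_subset_Ico_left (Nat.le_succ i)) fun _ _ _ => h0 _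
      _ = ∑ j ∈ range (n - i), f j := by
          rw [sum_Ico_eq_sum_range]
          refine sum_congr rfl fun j _ => ?_
          rw [← heven]; push_cast; ring_nf
      _ ≤ _ := sum_le_sum_of_subset_of_nonneg (range_mono (by omega)) fun _ _ _ => h0 _

/-- The difference is `2 sin s sin u` with `u` the half-difference and `s` the half-sum of the
angles. Here `sin s ≥ sin u`, and Jordan's inequality bounds `sin u`. -/
theorem two_mul_sq_le_abs_cos_sub_cos {N i j : ℕ} (hi : i < N + 1) (hj : j < N + 1) :
    2 * (((i : ℝ) - j) / (N + 1)) ^ 2 ≤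
      |Real.cos (chebAngle N i) - Real.cos (chebAngle N j)| := by
  wlog hij : j ≤ i generalizing i j
  · have := this hj hi (le_of_not_ge hij)
    rw [abs_sub_comm]
    refine le_trans (le_of_eq ?_) this
    ring
  have hpi := Real.pi_pos
  have hij' : (j : ℝ) ≤ i := by exact_mod_cast hij
  have hi' : (i : ℝ) + 1 ≤ N + 1 := by exact_mod_cast hi
  have hi1 := chebAngle_lt_pi hi
  have hj0 := chebAngle_pos N j
  set u : ℝ := (chebAngle N i - chebAngle N j) / 2 with hu
  set s : ℝ := (chebAngle N i + chebAngle N j) / 2 with hs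
  have hu' : u = (i - j) / (N + 1) * (Real.pi / 2) := by
    rw [hu, chebAngle, chebAngle]; field_simp; ring
  have hu0 : 0 ≤ u := by
    rw [hu']
    exact mul_nonneg (div_nonneg (by linarith) (by positivity)) (by positivity)
  have hx0 : 0 ≤ ((i : ℝ) - j) / (N + 1) := div_nonneg (by linarith) (by positivity)
  have h1 : ((i : ℝ) - j) / (N + 1) ≤ Real.sin u := by
    have := Real.mul_le_sin hu0 (by linarith)
    rw [hu'] at this ⊢
    refine le_trans (le_of_eq ?_) this
    field_simp
  have h2 : Real.sin u ≤ Real.sin s := by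
    have h3 : Real.sin s - Real.sin u = 2 * Real.sin (chebAngle N j / 2) *
        Real.cos (chebAngle N i / 2) := by
      rw [Real.sin_sub_sin]
      congr 2 <;> [congr 1; skip] <;> (rw [hs, hu]; ring)
    have h4 : 0 ≤ Real.sin (chebAngle N j / 2) :=
      Real.sin_nonneg_of_nonneg_of_le_pi (by linarith)
        (by have := chebAngle_lt_pi hj; linarith)
    have h5 : 0 ≤ Real.cos (chebAngle N i / 2) :=
      Real.cos_nonneg_of_neg_pi_div_two_le_of_le (by have := chebAngle_pos N i; linarith)
        (by linarith)
    have : 0 ≤ 2 * Real.sin (chebAngle N j / 2) * Real.cos (chebAngle N i / 2) := by positivity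
    linarith
  rw [Real.cos_sub_cos, ← hu, ← hs, abs_mul, abs_mul, abs_neg, abs_two,
    abs_of_nonneg (by linarith : 0 ≤ Real.sin s), abs_of_nonneg (by linarith : 0 ≤ Real.sin u)]
  have : (((i : ℝ) - j) / (N + 1)) ^ 2 ≤ Real.sin s * Real.sin u := by
    rw [sq]; exact mul_le_mul (h1.trans h2) h1 hx0 (by linarith)
  linarith

open Finset in
theorem sum_fejerSum_le {N : ℕ} {θ : ℕ → ℝ} {δ : ℝ} (hδ : 0 < δ) (h0 : ∀ i < N + 1, 0 ≤ θ i)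
    (hpi : ∀ i < N + 1, θ i ≤ Real.pi)
    (hsep : ∀ i < N + 1, ∀ j < N + 1, δ * (((i : ℝ) - j) / (N + 1)) ^ 2 ≤ |θ i - θ j|)
    {i : ℕ} (hi : i < N + 1) :
    ∑ j ∈ range (N + 1), fejerSum (2 * (N + 2)) (θ i - θ j) ≤
      (2 * (N + 2)) ^ 2 * (1 + Real.pi / (2 * δ)) * (8 * √(N + 1)) := by
  set R : ℝ := √(N + 1) with hR
  have hR2 : R ^ 2 = N + 1 := Real.sq_sqrt (by positivity)
  have hR1 : 1 ≤ R := by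
    rw [hR, Real.one_le_sqrt]
    have : (0 : ℝ) ≤ N := by positivity
    linarith
  set M : ℝ := 2 * (N + 2) with hM
  have hM0 : 0 < M := by positivity
  have hpp := Real.pi_pos
  set D : ℝ := 1 + Real.pi / (2 * δ) with hD
  have hpt : ∀ j ∈ range (N + 1), fejerSum (2 * (N + 2)) (θ i - θ j) ≤
      M ^ 2 * D * (R ^ 2 / (R ^ 2 + ((i : ℝ) - j) ^ 2)) := by
    intro j hj
    rw [mem_range] at hj
    set K := fejerSum (2 * (N + 2)) (θ i - θ j) with hK
    have hK0 : 0 ≤ K := fejerSum_nonneg _ _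
    have hK1 : K ≤ M ^ 2 := by
      have := fejerSum_le_sq (2 * (N + 2)) (θ i - θ j)
      push_cast at this
      exact this
    set d := |θ i - θ j| with hd
    have hd0 : 0 ≤ d := abs_nonneg _
    have hdpi : d ≤ Real.pi := by
      rw [hd, abs_le]
      have := h0 i hi; have := h0 j hj; have := hpi i hi; have := hpi j hj
      constructor <;> linarith
    have hK2 : K * d ^ 2 ≤ Real.pi ^ 2 := by
      have h1 := fejerSum_mul_sin_sq_le (2 * (N + 2)) (θ i - θ j)
      have h2 : 2 / Real.pi * (d / 2) ≤ Real.sin (d / 2) :=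
        Real.mul_le_sin (by positivity) (by linarith)
      have h3 : Real.sin ((θ i - θ j) / 2) ^ 2 = Real.sin (d / 2) ^ 2 := by
        rcases abs_choice (θ i - θ j) with e | e
        · rw [hd, e]
        · rw [hd, e, neg_div, Real.sin_neg, neg_sq]
      have h4 : (d / Real.pi) ^ 2 ≤ Real.sin (d / 2) ^ 2 := by
        refine pow_le_pow_left₀ (by positivity) (le_trans (le_of_eq ?_) h2) 2
        field_simp
      rw [h3] at h1
      have h5 : K * (d / Real.pi) ^ 2 ≤ 1 := (mul_le_mul_of_nonneg_left h4 hK0).trans h1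
      rw [div_pow, mul_div_assoc', div_le_one (by positivity)] at h5
      exact h5
    -- The geometric mean of the bounds `K ≤ M²` and `K d² ≤ π²`. Since `d` is at least quadratic in
    -- `i - j`, this decay already suffices for a Cauchy kernel of width `√(N + 1)`.
    have hK3 : K * d ≤ M * Real.pi := by
      refine abs_le_of_sq_le_sq' ?_ (by positivity) |>.2
      calc (K * d) ^ 2 = K * (K * d ^ 2) := by ring
        _ ≤ M ^ 2 * Real.pi ^ 2 := by gcongr
        _ = _ := by ring
    have hs := hsep i hi j hj
    rw [← hR2, ← hd] at hs
    have hK4 : K * ((i : ℝ) - j) ^ 2 ≤ M ^ 2 * (Real.pi / (2 * δ)) * R ^ 2 := by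
      have h1 : K * (δ * (((i : ℝ) - j) / R ^ 2) ^ 2) ≤ M * Real.pi :=
        (mul_le_mul_of_nonneg_left hs hK0).trans hK3
      have h2 : K * (δ * (((i : ℝ) - j) / R ^ 2) ^ 2) =
          K * ((i : ℝ) - j) ^ 2 * (δ / R ^ 4) := by field_simp
      rw [h2, mul_div_assoc', div_le_iff₀ (by positivity), ← le_div_iff₀ hδ] at h1
      refine h1.trans ?_
      rw [div_le_iff₀ hδ]
      have h3 : M ^ 2 * (Real.pi / (2 * δ)) * R ^ 2 * δ = M * Real.pi * (R ^ 2 * (M / 2)) := by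
        field_simp
      have h4 : R ^ 2 ≤ M / 2 := by rw [hR2, hM]; linarith
      rw [h3]
      refine mul_le_mul_of_nonneg_left ?_ (by positivity)
      nlinarith [sq_nonneg R]
    rw [mul_div_assoc', le_div_iff₀ (by positivity), hD]
    nlinarith [mul_le_mul_of_nonneg_right hK1 (sq_nonneg R)]
  refine (sum_le_sum hpt).trans ?_
  rw [← mul_sum]
  have hDpos : 0 < D := by positivity
  refine mul_le_mul_of_nonneg_left ?_ (by positivity)
  have h1 := sum_range_symm_le (f := fun x => R ^ 2 / (R ^ 2 + x ^ 2)) (fun x => by positivity)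
    (fun x => by simp) hi
  have h2 := sum_sq_div_sq_add_sq_le hR1 (N + 1)
  linarith

/-! ### Extreme singular values as optimal quadratic bounds -/

section SingularValues

open Finset

theorem norm_sq_toEuclideanLin {ι : Type*} [Fintype ι] [DecidableEq ι] (A : Matrix ι ι ℝ)
    (x : EuclideanSpace ℝ ι) :
    ‖Matrix.toEuclideanLin A x‖ ^ 2 = ∑ i, (∑ j, A i j * x j) ^ 2 := by
  rw [EuclideanSpace.real_norm_sq_eq]
  rfl

theorem LinearMap.norm_sq_eq_sum_singularValues {E : Type*} [NormedAddCommGroup E]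
    [InnerProductSpace ℝ E] [FiniteDimensional ℝ E] (T : E →ₗ[ℝ] E) {n : ℕ}
    (hn : Module.finrank ℝ E = n) (x : E) :
    ‖T x‖ ^ 2 = ∑ i : Fin n, T.singularValues i ^ 2 *
      ((T.isSymmetric_adjoint_comp_self.eigenvectorBasis hn).repr x i) ^ 2 := by
  set b := T.isSymmetric_adjoint_comp_self.eigenvectorBasis hn with hb
  have h1 : ‖T x‖ ^ 2 = inner ℝ ((LinearMap.adjoint T ∘ₗ T) x) x := by
    rw [LinearMap.comp_apply, LinearMap.adjoint_inner_left, real_inner_self_eq_norm_sq]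
  rw [h1, ← b.repr.inner_map_map, PiLp.inner_apply]
  refine sum_congr rfl fun i _ => ?_
  rw [hb, LinearMap.IsSymmetric.eigenvectorBasis_apply_self_apply, T.sq_singularValues_fin hn]
  simp
  ring

theorem LinearMap.norm_sq_le_singularValues_zero {E : Type*} [NormedAddCommGroup E]
    [InnerProductSpace ℝ E] [FiniteDimensional ℝ E] (T : E →ₗ[ℝ] E) (x : E) :
    ‖T x‖ ^ 2 ≤ T.singularValues 0 ^ 2 * ‖x‖ ^ 2 := by
  rw [T.norm_sq_eq_sum_singularValues rfl x,
    ← (T.isSymmetric_adjoint_comp_self.eigenvectorBasis rfl).repr.norm_map x,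
    EuclideanSpace.real_norm_sq_eq, mul_sum]
  refine sum_le_sum fun i _ => mul_le_mul_of_nonneg_right ?_ (sq_nonneg _)
  exact pow_le_pow_left₀ (T.singularValues_nonneg _) (T.singularValues_antitone (Nat.zero_le _)) 2

theorem LinearMap.singularValues_last_le_norm_sq {E : Type*} [NormedAddCommGroup E]
    [InnerProductSpace ℝ E] [FiniteDimensional ℝ E] (T : E →ₗ[ℝ] E) (x : E) :
    T.singularValues (Module.finrank ℝ E - 1) ^ 2 * ‖x‖ ^ 2 ≤ ‖T x‖ ^ 2 := by
  rw [T.norm_sq_eq_sum_singularValues rfl x,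
    ← (T.isSymmetric_adjoint_comp_self.eigenvectorBasis rfl).repr.norm_map x,
    EuclideanSpace.real_norm_sq_eq, mul_sum]
  refine sum_le_sum fun i _ => mul_le_mul_of_nonneg_right ?_ (sq_nonneg _)
  exact pow_le_pow_left₀ (T.singularValues_nonneg _)
    (T.singularValues_antitone (by have := i.2; omega)) 2

theorem LinearMap.exists_norm_eq_singularValues {E : Type*} [NormedAddCommGroup E]
    [InnerProductSpace ℝ E] [FiniteDimensional ℝ E] (T : E →ₗ[ℝ] E) {k : ℕ}
    (hk : k < Module.finrank ℝ E) : ∃ x : E, ‖x‖ = 1 ∧ ‖T x‖ ^ 2 = T.singularValues k ^ 2 := by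
  set b := T.isSymmetric_adjoint_comp_self.eigenvectorBasis rfl with hb
  refine ⟨b ⟨k, hk⟩, b.orthonormal.1 _, ?_⟩
  rw [T.norm_sq_eq_sum_singularValues rfl, sum_eq_single ⟨k, hk⟩]
  · simp [← hb]
  · intro i _ hi
    simp [← hb, hi]
  · simp

variable {ι : Type*} [Fintype ι] [DecidableEq ι] (A : Matrix ι ι ℝ)

theorem sum_sq_le_sigmaMax (x : ι → ℝ) :
    ∑ i, (∑ j, A i j * x j) ^ 2 ≤ sigmaMax A ^ 2 * ∑ i, x i ^ 2 := by
  have := (Matrix.toEuclideanLin A).norm_sq_le_singularValues_zero (WithLp.toLp 2 x)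
  rwa [norm_sq_toEuclideanLin, EuclideanSpace.real_norm_sq_eq] at this

theorem sigmaMin_mul_le_sum_sq (x : ι → ℝ) :
    sigmaMin A ^ 2 * ∑ i, x i ^ 2 ≤ ∑ i, (∑ j, A i j * x j) ^ 2 := by
  have := (Matrix.toEuclideanLin A).singularValues_last_le_norm_sq (WithLp.toLp 2 x)
  rwa [norm_sq_toEuclideanLin, EuclideanSpace.real_norm_sq_eq, finrank_euclideanSpace] at this

theorem sigmaMax_nonneg : 0 ≤ sigmaMax A := LinearMap.singularValues_nonneg _ _

theorem sigmaMin_nonneg : 0 ≤ sigmaMin A := LinearMap.singularValues_nonneg _ _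

variable [Nonempty ι]

theorem sigmaMax_sq_le {C : ℝ}
    (h : ∀ x : ι → ℝ, ∑ i, (∑ j, A i j * x j) ^ 2 ≤ C * ∑ i, x i ^ 2) : sigmaMax A ^ 2 ≤ C := by
  obtain ⟨x, hx, hx'⟩ := (Matrix.toEuclideanLin A).exists_norm_eq_singularValues (k := 0)
    (by rw [finrank_euclideanSpace]; exact Fintype.card_pos)
  have h1 := h x
  rw [← norm_sq_toEuclideanLin, ← EuclideanSpace.real_norm_sq_eq, hx', hx] at h1
  simpa [sigmaMax] using h1

theorem le_sigmaMin_sq {C : ℝ}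
    (h : ∀ x : ι → ℝ, C * ∑ i, x i ^ 2 ≤ ∑ i, (∑ j, A i j * x j) ^ 2) : C ≤ sigmaMin A ^ 2 := by
  have : 0 < Fintype.card ι := Fintype.card_pos
  obtain ⟨x, hx, hx'⟩ := (Matrix.toEuclideanLin A).exists_norm_eq_singularValues
    (k := Fintype.card ι - 1) (by rw [finrank_euclideanSpace]; omega)
  have h1 := h x
  rw [← norm_sq_toEuclideanLin, ← EuclideanSpace.real_norm_sq_eq, hx', hx] at h1
  simpa [sigmaMin] using h1

end SingularValues

/-! ### The constants `c(T)` and `E(T)` -/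

theorem cosConst_lt_one {T : ℝ} (hT : 1 < T) : cosConst T < 1 := by
  have hp := Real.pi_pos
  rw [cosConst, ← Real.cos_zero]
  exact Real.cos_lt_cos_of_nonneg_of_le_pi le_rfl
    (by rw [div_le_iff₀ (by linarith)]; nlinarith) (by positivity)

theorem neg_one_lt_cosConst {T : ℝ} (hT : 1 < T) : -1 < cosConst T := by
  have hp := Real.pi_pos
  rw [cosConst, ← Real.cos_pi]
  exact Real.cos_lt_cos_of_nonneg_of_le_pi (by positivity) le_rfl
    (by rw [div_lt_iff₀ (by linarith)]; nlinarith)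

theorem quarter_angle_mem {T : ℝ} (hT : 1 < T) :
    0 < Real.pi / (4 * T) ∧ Real.pi / (4 * T) < Real.pi / 4 := by
  have hp := Real.pi_pos
  exact ⟨by positivity, by
    rw [div_lt_div_iff₀ (by positivity) (by norm_num)]; nlinarith⟩

theorem one_lt_extConst {T : ℝ} (hT : 1 < T) : 1 < extConst T := by
  obtain ⟨h0, h1⟩ := quarter_angle_mem hT
  have hp := Real.pi_pos
  set u := Real.pi / (4 * T) with hu
  have hs : 0 < Real.sin u := Real.sin_pos_of_pos_of_lt_pi h0 (by linarith)
  have hsc : Real.sin u < Real.cos u := by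
    rw [← Real.cos_pi_div_two_sub]
    exact Real.cos_lt_cos_of_nonneg_of_le_pi (by linarith) (by linarith) (by linarith)
  rw [extConst, ← hu, Real.cot_eq_cos_div_sin]
  refine one_lt_pow₀ ?_ two_ne_zero
  rwa [one_lt_div hs]

/-- This identifies `E` as the parameter of the Bernstein ellipse through the affine image of `-1`.
It follows by writing `c = cos 4u` with `u = π / (4T)`. -/
theorem extConst_add_inv {T : ℝ} (hT : 1 < T) :
    (extConst T + (extConst T)⁻¹) / 2 = (3 + cosConst T) / (1 - cosConst T) := by
  obtain ⟨h0, h1⟩ := quarter_angle_mem hT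
  have hp := Real.pi_pos
  have hc4 : cosConst T = Real.cos (2 * (2 * (Real.pi / (4 * T)))) := by
    rw [cosConst]; congr 1; field_simp; norm_num
  have hd : 1 - cosConst T ≠ 0 := by have := cosConst_lt_one hT; linarith
  rw [hc4, Real.cos_two_mul, Real.cos_two_mul] at hd ⊢
  rw [extConst, Real.cot_eq_cos_div_sin]
  set u := Real.pi / (4 * T) with hu
  have hs : 0 < Real.sin u := Real.sin_pos_of_pos_of_lt_pi h0 (by linarith)
  have hcos : 0 < Real.cos u := Real.cos_pos_of_mem_Ioo ⟨by linarith, by linarith⟩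
  have h2 : Real.cos u ^ 2 = 1 - Real.sin u ^ 2 := by
    have := Real.sin_sq_add_cos_sq u; linarith
  have h3 : 1 - Real.sin u ^ 2 ≠ 0 := by rw [← h2]; positivity
  rw [div_pow, inv_div]
  rw [h2] at hd ⊢
  rw [eq_div_iff hd]
  field_simp
  ring

/-! ### Reduction of the matrix to cosine and sine polynomials -/

open Finset in
theorem sum_FEIndex (N : ℕ) (g : ℤ → ℝ) :
    ∑ m : FEIndex N, g m = ∑ k ∈ range (N + 1), g k + ∑ k ∈ range (N + 1), g (Int.negSucc k) := by
  rw [sum_coe_sort (Icc (-(N : ℤ) - 1) (N : ℤ)) g]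
  have h : Icc (-(N : ℤ) - 1) (N : ℤ) =
      (range (N + 1)).image (fun k : ℕ => (k : ℤ)) ∪ (range (N + 1)).image Int.negSucc := by
    ext m
    simp only [mem_Icc, mem_union, mem_image, mem_range]
    constructor
    · intro hm
      cases m with
      | ofNat k => exact Or.inl ⟨k, by simp at hm; omega, rfl⟩
      | negSucc k => exact Or.inr ⟨k, by omega, rfl⟩
    · rintro (⟨k, hk, rfl⟩ | ⟨k, hk, rfl⟩) <;> omega
  rw [h, sum_union, sum_image, sum_image]
  · intro a _ b _ hab; simpa using hab
  · intro a _ b _ hab; simpa using hab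
  · rw [disjoint_left]
    intro m h1 h2
    obtain ⟨a, -, rfl⟩ := mem_image.mp h1
    obtain ⟨b, -, hb⟩ := mem_image.mp h2
    omega

/-- The node `π x_n / T` in the variable of the Chebyshev polynomials. -/
noncomputable def feAngle (c : ℝ) (N n : ℕ) : ℝ := Real.arccos (chebNode c N n)

theorem chebNode_mem {c : ℝ} (hc : -1 < c) (hc' : c < 1) (N n : ℕ) :
    -1 < chebNode c N n ∧ chebNode c N n ≤ 1 := by
  have h1 := Real.neg_one_le_cos (chebAngle N n)
  have h2 := Real.cos_le_one (chebAngle N n)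
  constructor <;> (rw [chebNode]; nlinarith)

theorem cos_feAngle {c : ℝ} (hc : -1 < c) (hc' : c < 1) (N n : ℕ) :
    Real.cos (feAngle c N n) = chebNode c N n :=
  Real.cos_arccos (chebNode_mem hc hc' N n).1.le (chebNode_mem hc hc' N n).2

theorem mul_posNode {T : ℝ} (hT : 1 < T) (N n : ℕ) (k : ℝ) :
    k * Real.pi / T * posNode T N n = k * feAngle (cosConst T) N n := by
  have hp := Real.pi_pos
  have h : posNode T N n = T / Real.pi * feAngle (cosConst T) N n := by
    rw [posNode, feAngle, chebNode, chebAngle]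
    ring_nf
  rw [h]
  field_simp

open Finset in
/-- The squared norm of the image of a coefficient vector under the discrete Fourier extension
matrix, with cosine coefficients `a` and sine coefficients `b`. -/
noncomputable def dataSq (c : ℝ) (N : ℕ) (a b : ℕ → ℝ) : ℝ :=
  2 * Real.pi / (N + 1) *
    (∑ n ∈ range (N + 1), (∑ k ∈ range (N + 1), a k * Real.cos (k * feAngle c N n)) ^ 2 +
      ∑ n ∈ range (N + 1), (∑ k ∈ range (N + 1), b k * Real.sin ((k + 1) * feAngle c N n)) ^ 2)

open Finset in
theorem sum_sq_discMatrix {T : ℝ} (hT : 1 < T) (N : ℕ) (X : ℤ → ℝ) :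
    ∑ n : FEIndex N, (∑ m : FEIndex N, discMatrix T N n m * X m) ^ 2 =
      dataSq (cosConst T) N (fun k => X k) (fun k => X (Int.negSucc k)) := by
  have hp := Real.pi_pos
  set s := √(Real.pi / (N + 1)) with hs
  have hs2 : s ^ 2 = Real.pi / (N + 1) := Real.sq_sqrt (by positivity)
  set P : ℕ → ℝ := fun n =>
    ∑ k ∈ range (N + 1), X k * Real.cos (k * feAngle (cosConst T) N n) with hP
  set Q : ℕ → ℝ := fun n =>
    ∑ k ∈ range (N + 1), X (Int.negSucc k) * Real.sin ((k + 1) * feAngle (cosConst T) N n) with hQ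
  have hrow : ∀ n : FEIndex N, ∑ m : FEIndex N, discMatrix T N n m * X m =
      (fun n : ℤ => ∑ k ∈ range (N + 1), s * basisFun T k (mappedNode T N n) * X k +
        ∑ k ∈ range (N + 1), s * basisFun T (Int.negSucc k) (mappedNode T N n) *
          X (Int.negSucc k)) n := fun n =>
    sum_FEIndex N fun m => s * basisFun T m (mappedNode T N n) * X m
  simp_rw [hrow]
  rw [sum_FEIndex N (fun n : ℤ => (∑ k ∈ range (N + 1), s * basisFun T k (mappedNode T N n) * X k +
        ∑ k ∈ range (N + 1), s * basisFun T (Int.negSucc k) (mappedNode T N n) *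
          X (Int.negSucc k)) ^ 2)]
  have hpos : ∀ n : ℕ, (∑ k ∈ range (N + 1), s * basisFun T k (mappedNode T N n) * X k +
        ∑ k ∈ range (N + 1), s * basisFun T (Int.negSucc k) (mappedNode T N n) *
          X (Int.negSucc k)) = s * (P n + Q n) := by
    intro n
    rw [mul_add, hP, hQ, mul_sum, mul_sum]
    congr 1
    · refine sum_congr rfl fun k _ => ?_
      change s * Real.cos (k * Real.pi / T * posNode T N n) * X k = _
      rw [mul_posNode hT]; ring
    · refine sum_congr rfl fun k _ => ?_
      change s * Real.sin ((k + 1) * Real.pi / T * posNode T N n) * X (Int.negSucc k) = _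
      rw [mul_posNode hT]; ring
  have hneg : ∀ n : ℕ, (∑ k ∈ range (N + 1),
        s * basisFun T k (mappedNode T N (Int.negSucc n)) * X k +
        ∑ k ∈ range (N + 1), s * basisFun T (Int.negSucc k) (mappedNode T N (Int.negSucc n)) *
          X (Int.negSucc k)) = s * (P n - Q n) := by
    intro n
    rw [mul_sub, hP, hQ, mul_sum, mul_sum, sub_eq_add_neg, ← sum_neg_distrib]
    congr 1
    · refine sum_congr rfl fun k _ => ?_
      change s * Real.cos (k * Real.pi / T * -posNode T N n) * X k = _
      rw [mul_neg, Real.cos_neg, mul_posNode hT]; ring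
    · refine sum_congr rfl fun k _ => ?_
      change s * Real.sin ((k + 1) * Real.pi / T * -posNode T N n) * X (Int.negSucc k) = _
      rw [mul_neg, Real.sin_neg, mul_posNode hT]; ring
  -- The nodes `±x_n` contribute `(P + Q)² + (P - Q)² = 2 (P² + Q²)`, so the cosine and sine parts
  -- decouple.
  simp_rw [hpos, hneg]
  rw [dataSq, ← sum_add_distrib, ← sum_add_distrib, mul_sum]
  refine sum_congr rfl fun n _ => ?_
  rw [mul_pow, mul_pow, hs2]
  simp only [hP, hQ]
  ring

open Finset in
theorem exists_coeffs_dataSq {T : ℝ} (hT : 1 < T) (N : ℕ) (x : FEIndex N → ℝ) :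
    ∃ a b : ℕ → ℝ,
      ∑ i, x i ^ 2 = ∑ k ∈ range (N + 1), a k ^ 2 + ∑ k ∈ range (N + 1), b k ^ 2 ∧
      ∑ i, (∑ j, discMatrix T N i j * x j) ^ 2 = dataSq (cosConst T) N a b := by
  set X : ℤ → ℝ := fun m => if h : m ∈ Icc (-(N : ℤ) - 1) (N : ℤ) then x ⟨m, h⟩ else 0 with hX
  have hx : x = fun m : FEIndex N => X m := by
    funext m
    have : (m : ℤ) ∈ Icc (-(N : ℤ) - 1) (N : ℤ) := m.2
    simp only [hX]
    rw [dif_pos this]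
  refine ⟨fun k => X k, fun k => X (Int.negSucc k), ?_, ?_⟩
  · rw [hx]; exact sum_FEIndex N fun m => X m ^ 2
  · rw [hx]; exact sum_sq_discMatrix hT N X

open Finset in
theorem exists_vector_dataSq {T : ℝ} (hT : 1 < T) (N : ℕ) (a b : ℕ → ℝ) :
    ∃ x : FEIndex N → ℝ,
      ∑ i, x i ^ 2 = ∑ k ∈ range (N + 1), a k ^ 2 + ∑ k ∈ range (N + 1), b k ^ 2 ∧
      ∑ i, (∑ j, discMatrix T N i j * x j) ^ 2 = dataSq (cosConst T) N a b := by
  set X : ℤ → ℝ := fun m => match m with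
    | Int.ofNat k => a k
    | Int.negSucc k => b k with hX
  exact ⟨fun m => X m, sum_FEIndex N fun m => X m ^ 2, sum_sq_discMatrix hT N X⟩

open Polynomial Finset in
theorem exists_poly_cos_series (N : ℕ) (a : ℕ → ℝ) :
    ∃ p : ℝ[X], p.natDegree ≤ N ∧
      ∀ θ, p.eval (Real.cos θ) = ∑ k ∈ range (N + 1), a k * Real.cos (k * θ) := by
  refine ⟨∑ k ∈ range (N + 1), C (a k) * Chebyshev.T ℝ k, ?_, fun θ => ?_⟩
  · refine natDegree_sum_le_of_forall_le _ _ fun k hk => ?_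
    refine (natDegree_C_mul_le _ _).trans ?_
    rw [Chebyshev.natDegree_T]
    have := mem_range.mp hk
    simp; omega
  · simp [eval_finsetSum, Chebyshev.T_real_cos]

open Polynomial Finset in
theorem exists_poly_sin_series (N : ℕ) (b : ℕ → ℝ) :
    ∃ q : ℝ[X], q.natDegree ≤ N ∧
      ∀ θ, q.eval (Real.cos θ) * Real.sin θ =
        ∑ k ∈ range (N + 1), b k * Real.sin ((k + 1) * θ) := by
  refine ⟨∑ k ∈ range (N + 1), C (b k) * Chebyshev.U ℝ k, ?_, fun θ => ?_⟩
  · refine natDegree_sum_le_of_forall_le _ _ fun k hk => ?_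
    refine (natDegree_C_mul_le _ _).trans ?_
    rw [Chebyshev.natDegree_U_natCast]
    have := mem_range.mp hk
    omega
  · simp only [eval_finsetSum, eval_mul, eval_C, sum_mul, mul_assoc, Chebyshev.U_real_cos,
      Int.cast_natCast]

/-! ### Lower bounds for the quadratic form -/

-- One weighted inequality serves both parts: `sin² θ = 1 - y²` is exactly the weight of the sine
-- data, and the weight is at most `1` for the cosine data.
open Polynomial Finset in
theorem coeffs_le_dataSq {c : ℝ} (hc : -1 < c) (hc' : c < 1) {N : ℕ} {G : ℝ} (hG : 0 ≤ G)
    (h : ∀ p : ℝ[X], p.natDegree ≤ N →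
      ∑ j ∈ range (N + 1), p.eval (Real.cos (chebAngle N j)) ^ 2 ≤
        G * ∑ n ∈ range (N + 1), p.eval (chebNode c N n) ^ 2 * (1 - chebNode c N n ^ 2))
    (a b : ℕ → ℝ) :
    Real.pi * (∑ k ∈ range (N + 1), a k ^ 2 + ∑ k ∈ range (N + 1), b k ^ 2) ≤
      G * dataSq c N a b := by
  obtain ⟨p, hp, hpa⟩ := exists_poly_cos_series N a
  obtain ⟨q, hq, hqb⟩ := exists_poly_sin_series N b
  have ha := sum_sq_cos_series_ge N a
  have hb := sum_sq_sin_series_ge N b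
  simp_rw [← hpa] at ha
  simp_rw [← hqb] at hb
  have hb' : ∑ j ∈ range (N + 1),
      (q.eval (Real.cos (chebAngle N j)) * Real.sin (chebAngle N j)) ^ 2 ≤
      ∑ j ∈ range (N + 1), q.eval (Real.cos (chebAngle N j)) ^ 2 := by
    refine sum_le_sum fun j _ => ?_
    rw [mul_pow]
    exact mul_le_of_le_one_right (sq_nonneg _) (Real.sin_sq_le_one _)
  have hp1 : ∑ j ∈ range (N + 1), p.eval (Real.cos (chebAngle N j)) ^ 2 ≤
      G * ∑ n ∈ range (N + 1), p.eval (chebNode c N n) ^ 2 := by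
    refine (h p hp).trans (mul_le_mul_of_nonneg_left (sum_le_sum fun n _ => ?_) hG)
    exact mul_le_of_le_one_right (sq_nonneg _) (by nlinarith [sq_nonneg (chebNode c N n)])
  have hq1 := h q hq
  have hd : dataSq c N a b = 2 * Real.pi / (N + 1) *
      (∑ n ∈ range (N + 1), p.eval (chebNode c N n) ^ 2 +
        ∑ n ∈ range (N + 1), q.eval (chebNode c N n) ^ 2 * (1 - chebNode c N n ^ 2)) := by
    rw [dataSq]
    simp_rw [← hpa, ← hqb, mul_pow, Real.sin_sq, cos_feAngle hc hc']
  rw [hd]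
  have hp := Real.pi_pos
  have hN : (0 : ℝ) < N + 1 := by positivity
  have e : G * (2 * Real.pi / (N + 1) *
      (∑ n ∈ range (N + 1), p.eval (chebNode c N n) ^ 2 +
        ∑ n ∈ range (N + 1), q.eval (chebNode c N n) ^ 2 * (1 - chebNode c N n ^ 2))) =
      2 * Real.pi / (N + 1) * (G * ∑ n ∈ range (N + 1), p.eval (chebNode c N n) ^ 2 +
        G * ∑ n ∈ range (N + 1), q.eval (chebNode c N n) ^ 2 * (1 - chebNode c N n ^ 2)) := by
    ring
  rw [e]
  calc _ = 2 * Real.pi / (N + 1) * ((N + 1) / 2 * ∑ k ∈ range (N + 1), a k ^ 2 +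
        (N + 1) / 2 * ∑ k ∈ range (N + 1), b k ^ 2) := by field_simp
    _ ≤ _ := mul_le_mul_of_nonneg_left (by linarith) (by positivity)

theorem inv_le_sin_chebAngle {N n : ℕ} (hn : n < N + 1) :
    ((N : ℝ) + 1)⁻¹ ≤ Real.sin (chebAngle N n) := by
  have hp := Real.pi_pos
  have hn' : (n : ℝ) + 1 ≤ N + 1 := by exact_mod_cast hn
  have h0 := chebAngle_pos N n
  have h1 := chebAngle_lt_pi hn
  rcases le_total (chebAngle N n) (Real.pi / 2) with h | h
  · refine le_trans ?_ (Real.mul_le_sin h0.le h)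
    have : 2 / Real.pi * chebAngle N n = (2 * n + 1) / (N + 1) := by
      rw [chebAngle]; field_simp
    rw [this, ← one_div]
    gcongr
    have : (0 : ℝ) ≤ n := by positivity
    linarith
  · rw [← Real.sin_pi_sub]
    refine le_trans ?_ (Real.mul_le_sin (by linarith) (by linarith))
    have : 2 / Real.pi * (Real.pi - chebAngle N n) = (2 * (N - n) + 1) / (N + 1) := by
      rw [chebAngle]; field_simp; ring
    rw [this, ← one_div]
    gcongr
    linarith

/-- With `t = cos α`, `1 - y² = ((1-c)/2)² (1 - t²) + (1+c) ((1-c)/2) (1 - t)`. Dropping the second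
term loses powers of `N` but survives `c → -1`. -/
theorem le_one_sub_chebNode_sq {c : ℝ} (hc : -1 < c) (hc' : c < 1) {N n : ℕ} (hn : n < N + 1) :
    ((1 - c) / (2 * (N + 1))) ^ 2 ≤ 1 - chebNode c N n ^ 2 := by
  have h := inv_le_sin_chebAngle hn
  have hs : (((N : ℝ) + 1)⁻¹) ^ 2 ≤ Real.sin (chebAngle N n) ^ 2 :=
    pow_le_pow_left₀ (by positivity) h 2
  rw [Real.sin_sq] at hs
  have e : ((1 - c) / (2 * (N + 1))) ^ 2 = ((1 - c) / 2) ^ 2 * (((N : ℝ) + 1)⁻¹) ^ 2 := by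
    field_simp
  rw [e, chebNode]
  have h2 := Real.cos_le_one (chebAngle N n)
  set t := Real.cos (chebAngle N n)
  calc _ ≤ ((1 - c) / 2) ^ 2 * (1 - t ^ 2) := by gcongr
    _ ≤ ((1 - c) / 2) ^ 2 * (1 - t ^ 2) + (1 + c) * ((1 - c) / 2 * (1 - t)) := by
        have : 0 ≤ (1 + c) * ((1 - c) / 2 * (1 - t)) :=
          mul_nonneg (by linarith) (mul_nonneg (by linarith) (by linarith))
        linarith
    _ = _ := by ring

open Finset in
/-- Lower bound for the image of a coefficient vector with constants uniform in `c` near `-1`. -/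
theorem coeffs_le_dataSq_uniform {c E : ℝ} (hc : -1 < c) (hc' : c < 1) (hE : 1 < E)
    (hcE : (E + E⁻¹) / 2 = (3 + c) / (1 - c)) (N : ℕ) (a b : ℕ → ℝ) :
    Real.pi * (∑ k ∈ range (N + 1), a k ^ 2 + ∑ k ∈ range (N + 1), b k ^ 2) ≤
      8 * (N + 1) ^ 3 * E ^ (2 * N) / (1 - c) ^ 2 * dataSq c N a b := by
  have hd : 0 < 1 - c := by linarith
  refine coeffs_le_dataSq hc hc' (by positivity) (fun p hp => ?_) a b
  have h1 : ∑ j ∈ range (N + 1), p.eval (Real.cos (chebAngle N j)) ^ 2 ≤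
      (N + 1) * (2 * E ^ (2 * N) * ∑ n ∈ range (N + 1), p.eval (chebNode c N n) ^ 2) := by
    refine (sum_le_sum fun j _ => sq_eval_le_sum_chebNode hc' hE.le hcE hp
      (Real.neg_one_le_cos _) (Real.cos_le_one _)).trans ?_
    simp
  have h2 : ((1 - c) / (2 * (N + 1))) ^ 2 * ∑ n ∈ range (N + 1), p.eval (chebNode c N n) ^ 2 ≤
      ∑ n ∈ range (N + 1), p.eval (chebNode c N n) ^ 2 * (1 - chebNode c N n ^ 2) := by
    rw [mul_sum]
    refine sum_le_sum fun n hn => ?_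
    rw [mul_comm]
    exact mul_le_mul_of_nonneg_left (le_one_sub_chebNode_sq hc hc' (mem_range.mp hn))
      (sq_nonneg _)
  refine h1.trans ?_
  calc _ = 8 * (N + 1) ^ 3 * E ^ (2 * N) / (1 - c) ^ 2 * (((1 - c) / (2 * (N + 1))) ^ 2 *
        ∑ n ∈ range (N + 1), p.eval (chebNode c N n) ^ 2) := by field_simp; ring
    _ ≤ _ := by gcongr

open Finset in
/-- Sharp lower bound for the image of a coefficient vector, for fixed `c`. -/
theorem exists_coeffs_le_dataSq {c E : ℝ} (hc : -1 < c) (hc' : c < 1) (hE : 1 < E)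
    (hcE : (E + E⁻¹) / 2 = (3 + c) / (1 - c)) :
    ∃ K : ℝ, 0 < K ∧ ∀ N : ℕ, 1 ≤ N → ∀ a b : ℕ → ℝ,
      K * √(N + 1) / E ^ (2 * N) *
        (∑ k ∈ range (N + 1), a k ^ 2 + ∑ k ∈ range (N + 1), b k ^ 2) ≤ dataSq c N a b := by
  obtain ⟨C, hC, h⟩ := exists_sum_sq_eval_cos_le hc hc' hE hcE
  have hd : 0 < 1 - c := by linarith
  have hs : 0 < 1 + c := by linarith
  have hE0 : 0 < E := by linarith
  have hp := Real.pi_pos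
  refine ⟨Real.pi * ((1 + c) * ((1 - c) / 2)) / C, by positivity, fun N hN a b => ?_⟩
  have key := coeffs_le_dataSq hc hc' (N := N)
    (G := C * E ^ (2 * N) / √(N + 1) / ((1 + c) * ((1 - c) / 2))) (by positivity)
    (fun p hp => ?_) a b
  · set S := ∑ k ∈ range (N + 1), a k ^ 2 + ∑ k ∈ range (N + 1), b k ^ 2
    have hsq : 0 < √((N : ℝ) + 1) := by positivity
    calc _ = Real.pi * S / (C * E ^ (2 * N) / √(N + 1) / ((1 + c) * ((1 - c) / 2))) := by
          field_simp
      _ ≤ _ := by rw [div_le_iff₀ (by positivity)]; linarith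
  · refine (h N hN p hp).trans ?_
    have h2 : (1 + c) * ((1 - c) / 2) * ∑ n ∈ range (N + 1),
        p.eval (chebNode c N n) ^ 2 * (1 - Real.cos (chebAngle N n)) ≤
        ∑ n ∈ range (N + 1), p.eval (chebNode c N n) ^ 2 * (1 - chebNode c N n ^ 2) := by
      rw [mul_sum]
      refine sum_le_sum fun n _ => ?_
      -- Here the other term of `1 - y²` is kept: no power of `N` is lost, but the constant
      -- degenerates as `c → -1`.
      have h3 : (1 + c) * ((1 - c) / 2) * (1 - Real.cos (chebAngle N n)) ≤
          1 - chebNode c N n ^ 2 := by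
        have h4 := Real.neg_one_le_cos (chebAngle N n)
        have h5 := Real.cos_le_one (chebAngle N n)
        rw [chebNode]
        set t := Real.cos (chebAngle N n)
        have : 0 ≤ ((1 - c) / 2) ^ 2 * ((1 - t) * (1 + t)) :=
          mul_nonneg (sq_nonneg _) (mul_nonneg (by linarith) (by linarith))
        linarith
      calc _ = p.eval (chebNode c N n) ^ 2 *
            ((1 + c) * ((1 - c) / 2) * (1 - Real.cos (chebAngle N n))) := by ring
        _ ≤ _ := mul_le_mul_of_nonneg_left h3 (sq_nonneg _)
    rw [div_mul_eq_mul_div _ ((1 + c) * ((1 - c) / 2)), le_div_iff₀ (by positivity), mul_assoc,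
      mul_comm (∑ n ∈ range (N + 1), _) ((1 + c) * ((1 - c) / 2))]
    gcongr

/-! ### Upper bounds for the quadratic form -/

-- A matrix and its transpose have the same norm; this turns the large sieve for moments into a
-- bound for sampled trigonometric sums.
open Finset in
theorem sum_sq_le_of_dual {M n : ℕ} {f : ℕ → ℕ → ℝ} {C : ℝ} (hC : 0 ≤ C)
    (h : ∀ v : ℕ → ℝ, ∑ k ∈ range M, (∑ i ∈ range n, v i * f k i) ^ 2 ≤
      C * ∑ i ∈ range n, v i ^ 2) (a : ℕ → ℝ) :
    ∑ i ∈ range n, (∑ k ∈ range M, a k * f k i) ^ 2 ≤ C * ∑ k ∈ range M, a k ^ 2 := by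
  set v : ℕ → ℝ := fun i => ∑ k ∈ range M, a k * f k i with hv
  set S := ∑ i ∈ range n, v i ^ 2 with hS
  have hS0 : 0 ≤ S := sum_nonneg fun _ _ => sq_nonneg _
  have ha0 : 0 ≤ ∑ k ∈ range M, a k ^ 2 := sum_nonneg fun _ _ => sq_nonneg _
  have h1 : S = ∑ k ∈ range M, a k * ∑ i ∈ range n, v i * f k i := by
    simp_rw [mul_sum]
    rw [sum_comm, hS]
    refine sum_congr rfl fun i _ => ?_
    calc v i ^ 2 = v i * ∑ k ∈ range M, a k * f k i := by rw [sq]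
      _ = _ := by rw [mul_sum]; exact sum_congr rfl fun _ _ => by ring
  have h2 : S ^ 2 ≤ (∑ k ∈ range M, a k ^ 2) * (C * S) := by
    conv_lhs => rw [h1]
    exact (sum_mul_sq_le_sq_mul_sq _ _ _).trans (mul_le_mul_of_nonneg_left (h v) ha0)
  change S ≤ _
  rcases hS0.eq_or_lt with h0 | h0
  · rw [← h0]; positivity
  · nlinarith

open Finset in
theorem exists_dataSq_le {c : ℝ} (hc : -1 < c) (hc' : c < 1) :
    ∃ K : ℝ, 0 < K ∧ ∀ (N : ℕ) (a b : ℕ → ℝ), dataSq c N a b ≤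
      K * √(N + 1) * (∑ k ∈ range (N + 1), a k ^ 2 + ∑ k ∈ range (N + 1), b k ^ 2) := by
  have hd : 0 < 1 - c := by linarith
  have hp := Real.pi_pos
  set D : ℝ := 1 + Real.pi / (2 * (1 - c)) with hD
  have hD0 : 0 < D := by positivity
  refine ⟨2 * Real.pi * (64 * D), by positivity, fun N a b => ?_⟩
  set θ : ℕ → ℝ := feAngle c N with hθ
  have hrow := fun i (hi : i < N + 1) => sum_fejerSum_le (θ := θ) hd
    (fun _ _ => Real.arccos_nonneg _) (fun _ _ => Real.arccos_le_pi _) (fun i hi j hj => ?_) hi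
  · have hmom := mul_sum_sq_moments_le hrow
    set L : ℝ := (2 * (N + 2)) ^ 2 * D * (8 * √(N + 1)) with hL
    set C : ℝ := 64 * D * √(N + 1) * (N + 1) with hCdef
    have hLC : L ≤ C * (N + 2) := by
      have : C * (N + 2) - L = 32 * D * √(N + 1) * (N + 2) * N := by rw [hL, hCdef]; ring
      have : 0 ≤ 32 * D * √(N + 1) * (N + 2) * N := by positivity
      linarith
    -- The range `N + 2` covers the cosine frequencies `0, …, N` and the sine frequencies `1, …, N +
    -- 1` together.
    have hmom' : ∀ v : ℕ → ℝ, ∑ m ∈ range (N + 2),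
        ((∑ i ∈ range (N + 1), v i * Real.cos (m * θ i)) ^ 2 +
          (∑ i ∈ range (N + 1), v i * Real.sin (m * θ i)) ^ 2) ≤
        C * ∑ i ∈ range (N + 1), v i ^ 2 := by
      intro v
      have h1 := hmom v
      have hv : 0 ≤ ∑ i ∈ range (N + 1), v i ^ 2 := sum_nonneg fun _ _ => sq_nonneg _
      have h2 := h1.trans (mul_le_mul_of_nonneg_right hLC hv)
      rw [mul_comm C, mul_assoc] at h2
      push_cast at h2
      exact le_of_mul_le_mul_left h2 (by positivity)
    have hcos : ∀ v : ℕ → ℝ, ∑ m ∈ range (N + 1),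
        (∑ i ∈ range (N + 1), v i * Real.cos (m * θ i)) ^ 2 ≤
        C * ∑ i ∈ range (N + 1), v i ^ 2 := fun v => by
      refine le_trans ?_ (hmom' v)
      rw [sum_range_succ _ (N + 1)]
      exact le_add_of_le_of_nonneg (sum_le_sum fun _ _ => le_add_of_nonneg_right (sq_nonneg _))
        (by positivity)
    have hsin : ∀ v : ℕ → ℝ, ∑ m ∈ range (N + 1),
        (∑ i ∈ range (N + 1), v i * Real.sin ((m + 1) * θ i)) ^ 2 ≤
        C * ∑ i ∈ range (N + 1), v i ^ 2 := fun v => by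
      refine le_trans ?_ (hmom' v)
      rw [sum_range_succ' _ (N + 1)]
      refine le_add_of_le_of_nonneg (sum_le_sum fun m _ => ?_) (by positivity)
      push_cast
      exact le_add_of_nonneg_left (sq_nonneg _)
    have hC0 : 0 ≤ C := by positivity
    have ha := sum_sq_le_of_dual (f := fun k i => Real.cos (k * θ i)) hC0 hcos a
    have hb := sum_sq_le_of_dual (f := fun k i => Real.sin ((k + 1) * θ i)) hC0 hsin b
    rw [dataSq]
    calc _ ≤ 2 * Real.pi / (N + 1) * (C * ∑ k ∈ range (N + 1), a k ^ 2 +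
          C * ∑ k ∈ range (N + 1), b k ^ 2) := by gcongr
      _ = _ := by rw [hCdef]; field_simp
  -- Separation of the angles with `δ = 1 - c`: cosine is 1-Lipschitz, so the gaps between the nodes
  -- bound the gaps between the angles.
  · have h1 := two_mul_sq_le_abs_cos_sub_cos hi hj
    have h2 := Real.abs_cos_sub_cos_le (θ i) (θ j)
    rw [hθ, cos_feAngle hc hc', cos_feAngle hc hc'] at h2
    have e : chebNode c N i - chebNode c N j =
        (1 - c) / 2 * (Real.cos (chebAngle N i) - Real.cos (chebAngle N j)) := by
      rw [chebNode, chebNode]; ring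
    rw [e, abs_mul, abs_of_pos (by linarith : 0 < (1 - c) / 2)] at h2
    refine le_trans ?_ h2
    nlinarith

-- Plain Cauchy–Schwarz: weaker in `N` than `exists_dataSq_le`, but its constant is independent of
-- `c`.
open Finset in
theorem dataSq_le (c : ℝ) (N : ℕ) (a b : ℕ → ℝ) : dataSq c N a b ≤
    2 * Real.pi * (N + 1) * (∑ k ∈ range (N + 1), a k ^ 2 + ∑ k ∈ range (N + 1), b k ^ 2) := by
  have hp := Real.pi_pos
  have h : ∀ (v : ℕ → ℝ) (f : ℕ → ℕ → ℝ), (∀ k n, f k n ^ 2 ≤ 1) →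
      ∑ n ∈ range (N + 1), (∑ k ∈ range (N + 1), v k * f k n) ^ 2 ≤
        (N + 1) ^ 2 * ∑ k ∈ range (N + 1), v k ^ 2 := by
    intro v f hf
    have hv : 0 ≤ ∑ k ∈ range (N + 1), v k ^ 2 := sum_nonneg fun _ _ => sq_nonneg _
    have h1 : ∀ n ∈ range (N + 1), (∑ k ∈ range (N + 1), v k * f k n) ^ 2 ≤
        (∑ k ∈ range (N + 1), v k ^ 2) * (N + 1) := fun n _ =>
      (sum_mul_sq_le_sq_mul_sq _ _ _).trans (mul_le_mul_of_nonneg_left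
        ((sum_le_sum fun k _ => hf k n).trans (by simp)) hv)
    refine (sum_le_sum h1).trans (le_of_eq ?_)
    simp
    ring
  have ha := h a (fun k n => Real.cos (k * feAngle c N n)) fun _ _ => Real.cos_sq_le_one _
  have hb := h b (fun k n => Real.sin ((k + 1) * feAngle c N n)) fun _ _ => Real.sin_sq_le_one _
  rw [dataSq]
  calc _ ≤ 2 * Real.pi / (N + 1) * ((N + 1) ^ 2 * ∑ k ∈ range (N + 1), a k ^ 2 +
        (N + 1) ^ 2 * ∑ k ∈ range (N + 1), b k ^ 2) := by gcongr
    _ = _ := by field_simp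

/-! ### Test vectors -/

open Finset in
theorem dataSq_single (c : ℝ) (N : ℕ) :
    dataSq c N (fun k => if k = 0 then 1 else 0) 0 = 2 * Real.pi := by
  have : (N : ℝ) + 1 ≠ 0 := by positivity
  simp [dataSq]
  field_simp

-- The witness is the Chebyshev polynomial of `[c, 1]`: at most `1` in modulus at the nodes, yet at
-- least `E^N / 2` in modulus at `-1`, where its value is bounded by `∑ |a_k|`.
open Polynomial Finset in
theorem exists_coeffs_dataSq_le {c E : ℝ} (hc : -1 < c) (hc' : c < 1) (hE : 1 < E)
    (hcE : (E + E⁻¹) / 2 = (3 + c) / (1 - c)) (N : ℕ) :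
    ∃ a : ℕ → ℝ, E ^ (2 * N) ≤ 4 * (N + 1) * ∑ k ∈ range (N + 1), a k ^ 2 ∧
      dataSq c N a 0 ≤ 2 * Real.pi := by
  have hd : 0 < 1 - c := by linarith
  set p : ℝ[X] := (Chebyshev.T ℝ N).comp
    (Polynomial.C (2 / (1 - c)) * X + Polynomial.C (-(1 + c) / (1 - c))) with hp
  have hpd : p.natDegree ≤ N := natDegree_comp_affine_le (by simp) _ _
  have hpe : ∀ y, p.eval y = (Chebyshev.T ℝ N).eval ((2 * y - (1 + c)) / (1 - c)) := by
    intro y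
    rw [hp]
    simp
    congr 1
    field_simp
    ring
  obtain ⟨a, ha⟩ := (Chebyshev.chebyshevTsequence ℝ).exists_eq_sum hpd
  have hT : ∀ k : ℕ, Chebyshev.chebyshevTsequence ℝ k = Chebyshev.T ℝ k := fun _ => rfl
  simp_rw [hT] at ha
  refine ⟨a, ?_, ?_⟩
  · have h1 : |p.eval (-1)| = (Chebyshev.T ℝ N).eval ((E + E⁻¹) / 2) := by
      have e : (2 * (-1) - (1 + c)) / (1 - c) = -((E + E⁻¹) / 2) := by rw [hcE]; field_simp; ring
      have h0 : 0 ≤ (Chebyshev.T ℝ N).eval ((E + E⁻¹) / 2) :=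
        le_trans (by positivity) (pow_div_two_le_eval_chebyshevT hE.le N)
      rw [hpe, e, Chebyshev.T_eval_neg, abs_mul, abs_of_nonneg h0]
      rcases Int.even_or_odd (N : ℤ) with hk | hk
      · simp [Int.negOnePow_even _ hk]
      · simp [Int.negOnePow_odd _ hk]
    have h2 : E ^ N / 2 ≤ |p.eval (-1)| := h1 ▸ pow_div_two_le_eval_chebyshevT hE.le N
    have h3 : |p.eval (-1)| ≤ ∑ k ∈ range (N + 1), |a k| := by
      rw [ha]
      refine (abs_sum_le_sum_abs _ _).trans (sum_le_sum fun k _ => ?_)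
      rw [abs_mul]
      exact mul_le_of_le_one_right (abs_nonneg _)
        (Chebyshev.abs_eval_T_real_le_one k (by simp))
    have h4 : (∑ k ∈ range (N + 1), |a k|) ^ 2 ≤ (N + 1) * ∑ k ∈ range (N + 1), a k ^ 2 := by
      refine sq_sum_le_card_mul_sum_sq.trans (le_of_eq ?_)
      simp
    have h5 : (E ^ N / 2) ^ 2 ≤ (∑ k ∈ range (N + 1), |a k|) ^ 2 :=
      pow_le_pow_left₀ (by positivity) (h2.trans h3) 2
    have h6 : E ^ (2 * N) = 4 * (E ^ N / 2) ^ 2 := by ring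
    linarith
  · have h1 : ∀ n ∈ range (N + 1),
        (∑ k ∈ range (N + 1), a k * Real.cos (k * feAngle c N n)) ^ 2 ≤ 1 := by
      intro n _
      have h2 : ∑ k ∈ range (N + 1), a k * Real.cos (k * feAngle c N n) =
          p.eval (chebNode c N n) := by
        rw [← cos_feAngle hc hc', ha]
        simp [Chebyshev.T_real_cos]
      have h3 : (2 * chebNode c N n - (1 + c)) / (1 - c) = Real.cos (chebAngle N n) := by
        rw [chebNode]; field_simp; ring
      rw [h2, hpe, h3, Chebyshev.T_real_cos]
      exact Real.cos_sq_le_one _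
    have h2 := sum_le_sum h1
    have hp := Real.pi_pos
    rw [dataSq]
    calc _ ≤ 2 * Real.pi / (N + 1) * (∑ n ∈ range (N + 1), (1 : ℝ) + 0) := by
          gcongr; simp
      _ = _ := by simp; field_simp

/-! ### Singular values and condition number of the matrix -/

instance (N : ℕ) : Nonempty (FEIndex N) :=
  ⟨⟨0, Finset.mem_Icc.mpr ⟨by omega, by omega⟩⟩⟩

theorem one_le_sigmaMax_discMatrix {T : ℝ} (hT : 1 < T) (N : ℕ) :
    1 ≤ sigmaMax (discMatrix T N) := by
  obtain ⟨x, hx, hd⟩ := exists_vector_dataSq hT N (fun k => if k = 0 then 1 else 0) 0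
  have h := sum_sq_le_sigmaMax (discMatrix T N) x
  rw [hd, dataSq_single, hx] at h
  have h0 := sigmaMax_nonneg (discMatrix T N)
  simp at h
  nlinarith [Real.pi_gt_three]

theorem sigmaMax_discMatrix_sq_le {T : ℝ} (hT : 1 < T) (N : ℕ) :
    sigmaMax (discMatrix T N) ^ 2 ≤ 2 * Real.pi * (N + 1) := by
  refine sigmaMax_sq_le _ fun x => ?_
  obtain ⟨a, b, hx, hd⟩ := exists_coeffs_dataSq hT N x
  rw [hx, hd]
  exact dataSq_le _ _ _ _

theorem le_sigmaMin_discMatrix_sq {T : ℝ} (hT : 1 < T) (N : ℕ) :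
    Real.pi * (1 - cosConst T) ^ 2 / (8 * (N + 1) ^ 3 * extConst T ^ (2 * N)) ≤
      sigmaMin (discMatrix T N) ^ 2 := by
  refine le_sigmaMin_sq _ fun x => ?_
  obtain ⟨a, b, hx, hd⟩ := exists_coeffs_dataSq hT N x
  rw [hx, hd]
  have h := coeffs_le_dataSq_uniform (neg_one_lt_cosConst hT) (cosConst_lt_one hT)
    (one_lt_extConst hT) (extConst_add_inv hT) N a b
  have hc := cosConst_lt_one hT
  have hE := one_lt_extConst hT
  have hd : 0 < 1 - cosConst T := by linarith
  rw [div_mul_eq_mul_div, le_div_iff₀ (by positivity)] at h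
  rw [div_mul_eq_mul_div, div_le_iff₀ (by positivity)]
  linarith

theorem sigmaMin_discMatrix_sq_le {T : ℝ} (hT : 1 < T) (N : ℕ) :
    sigmaMin (discMatrix T N) ^ 2 ≤ 8 * Real.pi * (N + 1) / extConst T ^ (2 * N) := by
  obtain ⟨a, ha, hda⟩ := exists_coeffs_dataSq_le (neg_one_lt_cosConst hT) (cosConst_lt_one hT)
    (one_lt_extConst hT) (extConst_add_inv hT) N
  obtain ⟨x, hx, hd⟩ := exists_vector_dataSq hT N a 0
  have h := sigmaMin_mul_le_sum_sq (discMatrix T N) x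
  rw [hd, hx] at h
  have hE := one_lt_extConst hT
  rw [le_div_iff₀ (by positivity)]
  have h1 : sigmaMin (discMatrix T N) ^ 2 * ∑ k ∈ Finset.range (N + 1), a k ^ 2 ≤ 2 * Real.pi := by
    simpa using h.trans hda
  calc _ ≤ sigmaMin (discMatrix T N) ^ 2 *
        (4 * (N + 1) * ∑ k ∈ Finset.range (N + 1), a k ^ 2) := by gcongr
    _ = 4 * (N + 1) *
        (sigmaMin (discMatrix T N) ^ 2 * ∑ k ∈ Finset.range (N + 1), a k ^ 2) := by ring
    _ ≤ 4 * (N + 1) * (2 * Real.pi) := by gcongr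
    _ = _ := by ring

theorem sigmaMin_discMatrix_pos {T : ℝ} (hT : 1 < T) (N : ℕ) :
    0 < sigmaMin (discMatrix T N) := by
  have hE := one_lt_extConst hT
  have hd : 0 < 1 - cosConst T := by have := cosConst_lt_one hT; linarith
  have hp := Real.pi_pos
  have : 0 < sigmaMin (discMatrix T N) ^ 2 := lt_of_lt_of_le (by positivity)
    (le_sigmaMin_discMatrix_sq hT N)
  exact (sigmaMin_nonneg _).lt_of_ne fun h => by rw [← h] at this; simp at this

/-- The same factor `√(N + 1)` bounds `σ_max²` above and appears in the lower bound for `σ_min²`, so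
it cancels in the quotient. -/
theorem exists_condNumber_discMatrix_le {T : ℝ} (hT : 1 < T) :
    ∃ K : ℝ, 0 < K ∧ ∀ N : ℕ, 1 ≤ N → condNumber (discMatrix T N) ≤ K * extConst T ^ N := by
  have hc := neg_one_lt_cosConst hT
  have hc' := cosConst_lt_one hT
  have hE := one_lt_extConst hT
  obtain ⟨A, hA, hmax⟩ := exists_dataSq_le hc hc'
  obtain ⟨B, hB, hmin⟩ := exists_coeffs_le_dataSq hc hc' hE (extConst_add_inv hT)
  refine ⟨√(A / B), by positivity, fun N hN => ?_⟩
  have h1 : sigmaMax (discMatrix T N) ^ 2 ≤ A * √(N + 1) := by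
    refine sigmaMax_sq_le _ fun x => ?_
    obtain ⟨a, b, hx, hd⟩ := exists_coeffs_dataSq hT N x
    rw [hx, hd]
    exact hmax N a b
  have h2 : B * √(N + 1) / extConst T ^ (2 * N) ≤ sigmaMin (discMatrix T N) ^ 2 := by
    refine le_sigmaMin_sq _ fun x => ?_
    obtain ⟨a, b, hx, hd⟩ := exists_coeffs_dataSq hT N x
    rw [hx, hd]
    exact hmin N hN a b
  rw [condNumber, div_le_iff₀ (sigmaMin_discMatrix_pos hT N)]
  have hs := sigmaMin_nonneg (discMatrix T N)
  refine (abs_le_of_sq_le_sq' ?_ (by positivity)).2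
  rw [mul_pow, mul_pow, Real.sq_sqrt (by positivity), ← pow_mul, mul_comm N 2]
  calc _ ≤ A * √(N + 1) := h1
    _ = A / B * extConst T ^ (2 * N) * (B * √(N + 1) / extConst T ^ (2 * N)) := by field_simp
    _ ≤ _ := by gcongr

/-! ### Bounds in the stated powers of `N`, and the exponential rate -/

theorem rpow_neg_natCast_eq_inv {E : ℝ} (hE : 0 < E) (N : ℕ) : E ^ (-(N : ℝ)) = (E ^ N)⁻¹ := by
  rw [Real.rpow_neg hE.le, Real.rpow_natCast]

theorem rpow_sq_eq_pow {x s : ℝ} (hx : 0 ≤ x) {k : ℕ} (hk : s * 2 = k) :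
    (x ^ s) ^ 2 = x ^ k := by
  rw [← Real.rpow_natCast (x ^ s), ← Real.rpow_mul hx, Nat.cast_ofNat, hk, Real.rpow_natCast]

theorem sigmaMax_discMatrix_le {T : ℝ} (hT : 1 < T) {N : ℕ} (hN : 1 ≤ N) :
    sigmaMax (discMatrix T N) ≤ 4 * (N : ℝ) ^ (3 / 2 : ℝ) := by
  have hN1 : (1 : ℝ) ≤ N := by exact_mod_cast hN
  refine (abs_le_of_sq_le_sq' ?_ (by positivity)).2
  rw [mul_pow, rpow_sq_eq_pow (k := 3) (by positivity) (by norm_num)]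
  refine (sigmaMax_discMatrix_sq_le hT N).trans ?_
  calc 2 * Real.pi * (N + 1) ≤ 2 * 4 * (N + N) := by gcongr; exact Real.pi_le_four
    _ = 4 ^ 2 * (N : ℝ) := by ring
    _ ≤ _ := by gcongr; exact le_self_pow₀ hN1 (by norm_num)

theorem le_sigmaMin_discMatrix {T : ℝ} (hT : 1 < T) {N : ℕ} (hN : 1 ≤ N) :
    (1 - cosConst T) / 8 * (N : ℝ) ^ (-(3 / 2) : ℝ) * extConst T ^ (-(N : ℝ)) ≤
      sigmaMin (discMatrix T N) := by
  have hN1 : (1 : ℝ) ≤ N := by exact_mod_cast hN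
  have hE := one_lt_extConst hT
  have hd : 0 < 1 - cosConst T := by have := cosConst_lt_one hT; linarith
  refine (abs_le_of_sq_le_sq' ?_ (sigmaMin_nonneg _)).2
  refine le_trans ?_ (le_sigmaMin_discMatrix_sq hT N)
  rw [rpow_neg_natCast_eq_inv (by linarith), Real.rpow_neg (by positivity), mul_pow, mul_pow,
    inv_pow, inv_pow, rpow_sq_eq_pow (k := 3) (by positivity) (by norm_num), ← pow_mul,
    mul_comm N 2]
  -- Replacing `N + 1` by `2N` and `π` by `1` gives `(1 - c)² / 64`, the square of the constant `(1
  -- - c) / 8`.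
  calc _ = 1 * (1 - cosConst T) ^ 2 / (8 * ((N : ℝ) + N) ^ 3 * extConst T ^ (2 * N)) := by
        field_simp; norm_num
    _ ≤ _ := by gcongr; linarith [Real.pi_gt_three]

theorem sigmaMin_discMatrix_le {T : ℝ} (hT : 1 < T) {N : ℕ} (hN : 1 ≤ N) :
    sigmaMin (discMatrix T N) ≤ 8 * (N : ℝ) ^ (5 / 2 : ℝ) * extConst T ^ (-(N : ℝ)) := by
  have hN1 : (1 : ℝ) ≤ N := by exact_mod_cast hN
  have hE := one_lt_extConst hT
  refine (abs_le_of_sq_le_sq' ?_ (by positivity)).2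
  refine (sigmaMin_discMatrix_sq_le hT N).trans ?_
  rw [rpow_neg_natCast_eq_inv (by linarith), mul_pow, mul_pow,
    inv_pow, rpow_sq_eq_pow (k := 5) (by positivity) (by norm_num), ← pow_mul, mul_comm N 2,
    ← div_eq_mul_inv]
  refine div_le_div_of_nonneg_right ?_ (by positivity)
  calc 8 * Real.pi * (N + 1) ≤ 8 * 4 * (N + N) := by gcongr; exact Real.pi_le_four
    _ = 8 ^ 2 * (N : ℝ) := by ring
    _ ≤ _ := by gcongr; exact le_self_pow₀ hN1 (by norm_num)

theorem tendsto_const_rpow_one_div {K : ℝ} (hK : 0 < K) :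
    Tendsto (fun N : ℕ => K ^ (1 / (N : ℝ))) atTop (𝓝 1) := by
  have h := (Real.continuousAt_const_rpow (b := 0) hK.ne').tendsto.comp
    tendsto_one_div_atTop_nhds_zero_nat
  rw [Real.rpow_zero] at h
  exact h

theorem tendsto_natCast_rpow_one_div :
    Tendsto (fun N : ℕ => (N : ℝ) ^ (1 / (N : ℝ))) atTop (𝓝 1) :=
  tendsto_rpow_div.comp tendsto_natCast_atTop_atTop

theorem pow_rpow_one_div {E : ℝ} (hE : 0 ≤ E) {N : ℕ} (hN : N ≠ 0) :
    (E ^ N) ^ (1 / (N : ℝ)) = E := by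
  rw [one_div, Real.pow_rpow_inv_natCast hE hN]

theorem le_condNumber_discMatrix {T : ℝ} (hT : 1 < T) {N : ℕ} (hN : 1 ≤ N) :
    (8 * (N : ℝ) ^ (5 / 2 : ℝ))⁻¹ * extConst T ^ N ≤ condNumber (discMatrix T N) := by
  have hN1 : (1 : ℝ) ≤ N := by exact_mod_cast hN
  have hE := one_lt_extConst hT
  have hs := sigmaMin_discMatrix_pos hT N
  rw [condNumber, le_div_iff₀ hs]
  have h := sigmaMin_discMatrix_le hT hN
  rw [rpow_neg_natCast_eq_inv (by linarith)] at h
  refine le_trans ?_ (one_le_sigmaMax_discMatrix hT N)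
  calc _ ≤ (8 * (N : ℝ) ^ (5 / 2 : ℝ))⁻¹ * extConst T ^ N *
        (8 * (N : ℝ) ^ (5 / 2 : ℝ) * (extConst T ^ N)⁻¹) := by gcongr
    _ = 1 := by field_simp

theorem tendsto_condNumber_discMatrix_rpow {T : ℝ} (hT : 1 < T) :
    Tendsto (fun N : ℕ => condNumber (discMatrix T N) ^ (1 / (N : ℝ))) atTop
      (𝓝 (extConst T)) := by
  obtain ⟨K, hK, hup⟩ := exists_condNumber_discMatrix_le hT
  have hE := one_lt_extConst hT
  have hE0 : 0 < extConst T := by linarith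
  have hlow : Tendsto (fun N : ℕ => ((8 : ℝ) ^ (1 / (N : ℝ)) *
      ((N : ℝ) ^ (1 / (N : ℝ))) ^ (5 / 2 : ℝ))⁻¹ * extConst T) atTop (𝓝 (extConst T)) := by
    have h := (((tendsto_const_rpow_one_div (K := 8) (by norm_num)).mul
      (tendsto_natCast_rpow_one_div.rpow_const (p := 5 / 2) (Or.inl one_ne_zero))).inv₀
      (by simp)).mul_const (extConst T)
    simpa using h
  have hupp : Tendsto (fun N : ℕ => K ^ (1 / (N : ℝ)) * extConst T) atTop (𝓝 (extConst T)) := by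
    simpa using (tendsto_const_rpow_one_div hK).mul_const (extConst T)
  refine tendsto_of_tendsto_of_tendsto_of_le_of_le' hlow hupp ?_ ?_
  · filter_upwards [eventually_ge_atTop 1] with N hN
    have h := Real.rpow_le_rpow (by positivity) (le_condNumber_discMatrix hT hN)
      (by positivity : 0 ≤ 1 / (N : ℝ))
    rw [Real.mul_rpow (by positivity) (by positivity), pow_rpow_one_div hE0.le (by omega),
      Real.inv_rpow (by positivity), Real.mul_rpow (by positivity) (by positivity),
      ← Real.rpow_mul (by positivity), mul_comm (5 / 2 : ℝ), Real.rpow_mul (by positivity)] at h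
    exact h
  · filter_upwards [eventually_ge_atTop 1] with N hN
    have h0 : 0 ≤ condNumber (discMatrix T N) := div_nonneg (sigmaMax_nonneg _) (sigmaMin_nonneg _)
    have h := Real.rpow_le_rpow h0 (hup N hN) (by positivity : 0 ≤ 1 / (N : ℝ))
    rwa [Real.mul_rpow hK.le (by positivity), pow_rpow_one_div hE0.le (by omega)] at h

theorem isTheta_one_of_tendsto {f : ℝ → ℝ} {l : Filter ℝ} {x : ℝ} (hx : x ≠ 0)
    (h : Tendsto f l (𝓝 x)) : f =Θ[l] fun _ => (1 : ℝ) :=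
  (isTheta_of_div_tendsto_nhds_ne_zero (c := x) (by simpa using h) hx).symm

theorem theoremt :
    (∃ c₁ c₂ d₁ d₂ : ℝ → ℝ,
      (∀ T : ℝ, 1 < T → 0 < c₁ T ∧ 0 < c₂ T ∧ 0 < d₁ T ∧ 0 < d₂ T) ∧
      (c₁ =Θ[𝓝[>] 1] fun _ => (1 : ℝ)) ∧ (c₂ =Θ[𝓝[>] 1] fun _ => (1 : ℝ)) ∧
      (d₁ =Θ[𝓝[>] 1] fun _ => (1 : ℝ)) ∧ (d₂ =Θ[𝓝[>] 1] fun _ => (1 : ℝ)) ∧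
      ∀ T : ℝ, 1 < T → ∀ N : ℕ, 1 ≤ N →
        c₁ T ≤ sigmaMax (discMatrix T N) ∧
        sigmaMax (discMatrix T N) ≤ c₂ T * (N : ℝ) ^ (3 / 2 : ℝ) ∧
        d₁ T * (N : ℝ) ^ (-(3 / 2) : ℝ) * extConst T ^ (-(N : ℝ)) ≤ sigmaMin (discMatrix T N) ∧
        sigmaMin (discMatrix T N) ≤ d₂ T * (N : ℝ) ^ (5 / 2 : ℝ) * extConst T ^ (-(N : ℝ))) ∧
    ∀ T : ℝ, 1 < T →
      ((fun N : ℕ => condNumber (discMatrix T N)) =O[atTop] fun N : ℕ => extConst T ^ N) ∧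
      Tendsto (fun N : ℕ => condNumber (discMatrix T N) ^ (1 / (N : ℝ))) atTop
        (𝓝 (extConst T)) := by
  -- Only `d₁` depends on `T`; since `c(1) = -1`, it tends to `1 / 4` as `T → 1⁺`.
  refine ⟨⟨fun _ => 1, fun _ => 4, fun T => (1 - cosConst T) / 8, fun _ => 8, fun T hT => ?_,
    isTheta_one_of_tendsto one_ne_zero tendsto_const_nhds,
    isTheta_one_of_tendsto four_ne_zero tendsto_const_nhds,
    isTheta_one_of_tendsto (x := 1 / 4) (by norm_num) ?_,
    isTheta_one_of_tendsto (x := 8) (by norm_num) tendsto_const_nhds, fun T hT N hN =>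
      ⟨one_le_sigmaMax_discMatrix hT N, sigmaMax_discMatrix_le hT hN,
        le_sigmaMin_discMatrix hT hN, sigmaMin_discMatrix_le hT hN⟩⟩, fun T hT =>
      ⟨?_, tendsto_condNumber_discMatrix_rpow hT⟩⟩
  · have := cosConst_lt_one hT
    exact ⟨one_pos, by norm_num, by linarith, by norm_num⟩
  · have hcont : ContinuousAt (fun T : ℝ => (1 - cosConst T) / 8) 1 := by
      unfold cosConst
      have h1 : ContinuousAt (fun T : ℝ => Real.pi / T) 1 :=
        continuousAt_const.div continuousAt_id one_ne_zero
      exact (continuousAt_const.sub (Real.continuous_cos.continuousAt.comp h1)).div_const 8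
    have h := hcont.tendsto.mono_left (nhdsWithin_le_nhds (s := Set.Ioi 1))
    have e : (1 - cosConst 1) / 8 = 1 / 4 := by
      rw [cosConst, div_one, Real.cos_pi]; norm_num
    rwa [e] at h
  · obtain ⟨K, hK, hup⟩ := exists_condNumber_discMatrix_le hT
    have hE := one_lt_extConst hT
    refine IsBigO.of_bound K ?_
    filter_upwards [eventually_ge_atTop 1] with N hN
    have h0 : 0 ≤ condNumber (discMatrix T N) := div_nonneg (sigmaMax_nonneg _) (sigmaMin_nonneg _)
    rw [Real.norm_of_nonneg h0, Real.norm_of_nonneg (by positivity)]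
    exact hup N hN
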